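/- Conventions. For $n\ge 1$, $c\in\mathbb{Q}_{\ge0}^n$, a finite set $B\subseteq[0,1]^n$ and $x\in[0,1]^n$ let $c_B(x)=\min\{c^{\top}b : b\in B,\ x\le b\}$ (and $c_B(x)=\infty$ if no $b\in B$ satisfies $x\le b$ coordinatewise). A finite set $B$ is a Pareto cover of a probability measure $\mu$ on $[0,1]^n$ if $\mu(\{x : x\le b\text{ for some }b\in B\})=1$. Given $\mu,c$ and $k\ge1$, the feasible solutions are the Pareto covers $B\subseteq[0,1]^n$ of $\mu$ with $|B|=k$; $\mathrm{OPT}$ is the infimum of $\mathrm{E}_\mu[c_B]$ over them; $B$ is an $r$-approximate solution if it is feasible and $\mathrm{E}_\mu[c_B]\le r\cdot\mathrm{OPT}$. A probability measure $\mu$ on $[0,1]$ is nice if it has an oracle $\sigma$ which, for all rationals $-1\le a<b\le1$ and $\delta\in(0,1)$, returns, in time polynomial in the encoding lengths of $a,b,\delta$, a rational $\sigma(a,b,\delta)\ge0$ with $(1+\delta)^{-1}\mu((a,b]\cap[0,1])\le\sigma(a,b,\delta)\le(1+\delta)\,\mu((a,b]\cap[0,1])$. An instance $I$ of the general Pareto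 cover problem consists of $n\ge1$, oracles $\sigma_1,\dots,\sigma_n$ for nice measures $\mu_1,\dots,\mu_n$ on $[0,1]$, $c\in\mathbb{Q}^n_{\ge0}$, an integer $k\ge1$ and a rational $\alpha\in(0,1)$ with $\alpha\le\mathrm{E}_{X\sim\mu_i}[X]$ for all $i$; its measure is $\prod_i\mu_i$. Algorithms access the $\mu_i$ only by querying the $\sigma_i$, a query is charged the running time of the oracle, and $\mathrm{size}(I)$ is the binary encoding length of $n,k,\alpha,c$ (the oracles count $0$). An instance of the discrete Pareto cover problem consists of $M\ge0$, rationals $0=a_0<a_1<\dots<a_{M+1}=1$, rationals $p^i_j\in[0,1]$ with $\sum_{j=0}^{M+1}p^i_j=1$ for $i=1,\dots,n$, $c\in\mathbb{Q}^n_{\ge0}$ and an integer $k\ge1$; its measure is the product of the measures $\sum_j p^i_j\,\delta_{a_j}$. Theorem. Let $I$ be an instance of the general Pareto cover problem and let $\gamma>0$ be rational. Put $\epsilon=\frac{\min\{\gamma,1\}}{60n}$, $M=\lceil\log_{1+\epsilon}((\epsilon\alpha)^{-1})\rceil$, $q_{-1}=-1$, $q_0=0$, $q_\ell=\epsilon\alpha(1+\epsilon)^{\ell-1}$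 for $1\le\ell\le M$, $q_{M+1}=1$, and $$p^i_\ell=\frac{\sigma_i(q_{\ell-1},q_\ell,\epsilon)}{\sum_{t=0}^{M+1}\sigma_i(q_{t-1},q_t,\epsilon)}\qquad(1\le i\le n,\ 0\le\ell\le M+1).$$ Then $I_\gamma=(M,(q_\ell)_{\ell=0}^{M+1},(p^i_\ell),c,k)$ is an instance of the discrete Pareto cover problem, and every $(1+\frac{\gamma}{15})$-approximate solution to $I_\gamma$ is a $(1+\gamma)$-approximate solution to $I$. Moreover, a single algorithm computes $I_\gamma$ from every input $(I,\gamma)$ in time polynomial in $\gamma^{-1}$ and in the encoding length of the input, that is, $\mathrm{size}(I)$ plus the encoding length of $\gamma$: for every polynomial $P$ there is a polynomial $T$ such that, whenever the oracles of $I$ run in time $P$ (in the encoding length of the query), the running time is at most $T(\lceil\gamma^{-1}\rceil+\mathrm{size}(I)+\mathrm{size}(\gamma))$. -/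

import Mathlib

open MeasureTheory
open scoped ENNReal

namespace ParetoCover

noncomputable section

/-! ## Pareto covers of measures on the cube -/

/-- `μ`-almost every point of `[0,1]^n` lies below some point of `B`. -/
def IsParetoCover {n : ℕ} (μ : Measure (Fin n → unitInterval))
    (B : Finset (Fin n → unitInterval)) : Prop :=
  μ {x | ∃ b ∈ B, x ≤ b} = 1

/-- `c_B(x) = min {∑ i, c i * b i : b ∈ B, x ≤ b}`, and `∞` if no point of `B` covers `x`. -/
def coverCost {n : ℕ} (c : Fin n → ℚ) (B : Finset (Fin n → unitInterval))
    (x : Fin n → unitInterval) : ℝ≥0∞ :=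
  ⨅ b ∈ B, ⨅ _ : x ≤ b, ENNReal.ofReal (∑ i, (c i : ℝ) * (b i : ℝ))

/-- The expectation of `c_B`. -/
def expectedCost {n : ℕ} (μ : Measure (Fin n → unitInterval)) (c : Fin n → ℚ)
    (B : Finset (Fin n → unitInterval)) : ℝ≥0∞ :=
  ∫⁻ x, coverCost c B x ∂μ

/-- Feasible solutions: Pareto covers with exactly `k` points. -/
def IsSolution {n : ℕ} (μ : Measure (Fin n → unitInterval)) (k : ℕ)
    (B : Finset (Fin n → unitInterval)) : Prop :=
  B.card = k ∧ IsParetoCover μ B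

/-- The optimum value. -/
def optCost {n : ℕ} (μ : Measure (Fin n → unitInterval)) (c : Fin n → ℚ) (k : ℕ) : ℝ≥0∞ :=
  ⨅ (B : Finset (Fin n → unitInterval)) (_ : IsSolution μ k B), expectedCost μ c B

/-- `B` is feasible and its cost is at most `r` times the optimum. -/
def IsApproxSolution {n : ℕ} (μ : Measure (Fin n → unitInterval)) (c : Fin n → ℚ) (k : ℕ)
    (r : ℝ) (B : Finset (Fin n → unitInterval)) : Prop :=
  IsSolution μ k B ∧ expectedCost μ c B ≤ ENNReal.ofReal r * optCost μ c k

/-! ## Encoding lengths and oracles -/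

/-- Binary encoding length of a rational number: sign, numerator and denominator
(`Nat.size m` is the number of binary digits of `m`). -/
def ratSize (q : ℚ) : ℕ := 1 + Nat.size q.num.natAbs + Nat.size q.den

/-- A black box: `ans a b δ` is the answer to the query `(a, b, δ)`, and `time a b δ` is the time
the black box needs to answer. -/
structure Oracle where
  ans : ℚ → ℚ → ℚ → ℚ
  time : ℚ → ℚ → ℚ → ℕ

/-- The queries an oracle admits. -/
def ValidQuery (a b δ : ℚ) : Prop := -1 ≤ a ∧ a < b ∧ b ≤ 1 ∧ 0 < δ ∧ δ < 1

/-- On admissible queries, the answers are nonnegative and approximate `μ ((a, b] ∩ [0, 1])`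
within a factor of `1 + δ`. -/
def Oracle.Approximates (σ : Oracle) (μ : Measure unitInterval) : Prop :=
  ∀ a b δ : ℚ, ValidQuery a b δ →
    0 ≤ σ.ans a b δ ∧
    (1 + (δ : ℝ))⁻¹ * μ.real {x : unitInterval | (a : ℝ) < x ∧ (x : ℝ) ≤ b} ≤ (σ.ans a b δ : ℝ) ∧
    (σ.ans a b δ : ℝ) ≤ (1 + (δ : ℝ)) * μ.real {x : unitInterval | (a : ℝ) < x ∧ (x : ℝ) ≤ b}

/-- On admissible queries, the time is bounded by the polynomial `P` in the encoding length of the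
query; writing down the answer is part of the time. -/
def Oracle.RunsWithin (σ : Oracle) (P : Polynomial ℕ) : Prop :=
  ∀ a b δ : ℚ, ValidQuery a b δ →
    ratSize (σ.ans a b δ) ≤ σ.time a b δ ∧
    σ.time a b δ ≤ P.eval (ratSize a + ratSize b + ratSize δ)

/-- `σ` witnesses that `μ` is a nice measure. -/
def Oracle.IsNiceFor (σ : Oracle) (μ : Measure unitInterval) : Prop :=
  σ.Approximates μ ∧ ∃ P : Polynomial ℕ, σ.RunsWithin P

/-! ## Instances -/

/-- Instances of the general Pareto cover problem in dimension `n`. -/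
structure Instance (n : ℕ) where
  μ : Fin n → Measure unitInterval
  isProb : ∀ i, IsProbabilityMeasure (μ i)
  oracle : Fin n → Oracle
  nice : ∀ i, (oracle i).IsNiceFor (μ i)
  c : Fin n → ℚ
  c_nonneg : ∀ i, 0 ≤ c i
  k : ℕ
  one_le_k : 1 ≤ k
  α : ℚ
  α_pos : 0 < α
  α_lt_one : α < 1
  α_le : ∀ i, (α : ℝ) ≤ ∫ x, (x : ℝ) ∂(μ i)

/-- The product measure of the instance. -/
def Instance.measure {n : ℕ} (I : Instance n) : Measure (Fin n → unitInterval) :=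
  Measure.pi I.μ

/-- Binary encoding length of the instance; the oracles contribute nothing. -/
def Instance.size {n : ℕ} (I : Instance n) : ℕ :=
  Nat.size n + Nat.size I.k + ratSize I.α + ∑ i, ratSize (I.c i)

/-- Instances of the discrete Pareto cover problem in dimension `n`. -/
structure DiscreteInstance (n : ℕ) where
  M : ℕ
  a : Fin (M + 2) → ℚ
  a_strictMono : StrictMono a
  a_zero : a 0 = 0
  a_last : a (Fin.last (M + 1)) = 1
  p : Fin n → Fin (M + 2) → ℚ
  p_mem : ∀ i j, p i j ∈ Set.Icc (0 : ℚ) 1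
  p_sum : ∀ i, ∑ j, p i j = 1
  c : Fin n → ℚ
  c_nonneg : ∀ i, 0 ≤ c i
  k : ℕ
  one_le_k : 1 ≤ k

theorem DiscreteInstance.a_mem {n : ℕ} (J : DiscreteInstance n) (j : Fin (J.M + 2)) :
    (J.a j : ℝ) ∈ unitInterval := by
  have h0 : J.a 0 ≤ J.a j := J.a_strictMono.monotone (Fin.zero_le j)
  have h1 : J.a j ≤ J.a (Fin.last (J.M + 1)) := J.a_strictMono.monotone (Fin.le_last j)
  rw [J.a_zero] at h0
  rw [J.a_last] at h1
  exact ⟨by exact_mod_cast h0, by exact_mod_cast h1⟩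

/-- The distribution of coordinate `i`: mass `p i j` at the point `a j`. -/
def DiscreteInstance.marginal {n : ℕ} (J : DiscreteInstance n) (i : Fin n) :
    Measure unitInterval :=
  ∑ j, ENNReal.ofReal (J.p i j : ℝ) • Measure.dirac (⟨(J.a j : ℝ), J.a_mem j⟩ : unitInterval)

/-- The product of the marginal distributions. -/
def DiscreteInstance.measure {n : ℕ} (J : DiscreteInstance n) :
    Measure (Fin n → unitInterval) :=
  Measure.pi J.marginal

/-! ## The reduced instance -/

/-- `M = ⌈log_{1+ε} (1 / (ε α))⌉`. -/
def queryCount (ε α : ℚ) : ℕ := ⌈Real.logb (1 + (ε : ℝ)) ((ε : ℝ) * α)⁻¹⌉₊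

/-- The query coordinates `q_0 = 0`, `q_l = ε α (1+ε)^(l-1)` for `1 ≤ l ≤ M`, `q_{M+1} = 1`. -/
def queryCoord (ε α : ℚ) (l : ℕ) : ℚ :=
  if l = 0 then 0
  else if l ≤ queryCount ε α then ε * α * (1 + ε) ^ (l - 1)
  else 1

/-- `q_{l-1}`, where `q_{-1} = -1`. -/
def queryPrev (ε α : ℚ) (l : ℕ) : ℚ := if l = 0 then -1 else queryCoord ε α (l - 1)

/-- The oracle's approximation of the mass of `(q_{l-1}, q_l]`. -/
def queryWeight (σ : Oracle) (ε α : ℚ) (l : ℕ) : ℚ :=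
  σ.ans (queryPrev ε α l) (queryCoord ε α l) ε

/-- The accuracy that belongs to the parameter `γ` in dimension `n`. -/
def accuracy (n : ℕ) (γ : ℚ) : ℚ := min γ 1 / (60 * n)

/-- `J` is the discrete instance with the query coordinates as grid, the normalized oracle answers
as probabilities, and the costs and the cover size of `I`. -/
structure IsReducedInstance {n : ℕ} (I : Instance n) (γ : ℚ) (J : DiscreteInstance n) :
    Prop where
  k_eq : J.k = I.k
  c_eq : J.c = I.c
  M_eq : J.M = queryCount (accuracy n γ) I.α
  a_eq : ∀ j, J.a j = queryCoord (accuracy n γ) I.α j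
  p_eq : ∀ i j, J.p i j =
    queryWeight (I.oracle i) (accuracy n γ) I.α j /
      ∑ t ∈ Finset.range (queryCount (accuracy n γ) I.α + 2),
        queryWeight (I.oracle i) (accuracy n γ) I.α t

/-! ## Oracle programs and their bit cost

A random access machine with finitely many arrays of rational numbers, in logarithmic cost: every
operation is charged the encoding lengths of the numbers that it handles. -/

/-- The memory: `s A l` is entry `l` of array `A`. -/
abbrev Store := ℕ → ℕ → ℚ

/-- Expressions. The array of a `read` is fixed in the program, its position is computed. -/
inductive Expr where
  | lit (q : ℚ)
  | read (arr : ℕ) (pos : Expr)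
  | add (x y : Expr)
  | sub (x y : Expr)
  | mul (x y : Expr)
  | div (x y : Expr)
  | floor (x : Expr)

/-- The value of an expression. -/
def Expr.val (s : Store) : Expr → ℚ
  | .lit q => q
  | .read A e => s A ⌊e.val s⌋₊
  | .add x y => x.val s + y.val s
  | .sub x y => x.val s - y.val s
  | .mul x y => x.val s * y.val s
  | .div x y => x.val s / y.val s
  | .floor x => (⌊x.val s⌋ : ℚ)

/-- The bit cost of evaluating an expression: the total encoding length of all the values that
occur in the evaluation. -/
def Expr.cost (s : Store) : Expr → ℕ
  | .lit q => ratSize q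
  | .read A e => e.cost s + ratSize (s A ⌊e.val s⌋₊)
  | .add x y => x.cost s + y.cost s + ratSize (x.val s + y.val s)
  | .sub x y => x.cost s + y.cost s + ratSize (x.val s - y.val s)
  | .mul x y => x.cost s + y.cost s + ratSize (x.val s * y.val s)
  | .div x y => x.cost s + y.cost s + ratSize (x.val s / y.val s)
  | .floor x => x.cost s + ratSize (⌊x.val s⌋ : ℚ)

/-- Programs. `write A e x` stores `x` at position `e` of array `A`; `ite` and `loop` test whether
the value of an expression is positive; `query A e i a b δ` stores the answer of oracle number `i`
to the query `(a, b, δ)` at position `e` of array `A`. -/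
inductive Program where
  | skip
  | write (arr : ℕ) (pos x : Expr)
  | query (arr : ℕ) (pos i a b δ : Expr)
  | seq (P Q : Program)
  | ite (test : Expr) (P Q : Program)
  | loop (test : Expr) (P : Program)

/-- The memory after storing `q` at position `l` of array `A`. -/
def Store.set (s : Store) (A l : ℕ) (q : ℚ) : Store :=
  Function.update s A (Function.update (s A) l q)

/-- `Exec σ P s s' t`: with access to the oracles `σ`, the program `P`, started on the memory `s`,
halts with the memory `s'` at total cost `t`. Only admissible queries can be executed, and a query
is charged the time of the oracle. -/
inductive Exec {n : ℕ} (σ : Fin n → Oracle) : Program → Store → Store → ℕ → Prop where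
  | skip (s : Store) : Exec σ .skip s s 1
  | write (s : Store) (A : ℕ) (e x : Expr) :
      Exec σ (.write A e x) s (s.set A ⌊e.val s⌋₊ (x.val s)) (1 + e.cost s + x.cost s)
  | query (s : Store) (A : ℕ) (e i a b δ : Expr) (m : Fin n) (hm : i.val s = ((m : ℕ) : ℚ))
      (hq : ValidQuery (a.val s) (b.val s) (δ.val s)) :
      Exec σ (.query A e i a b δ) s
        (s.set A ⌊e.val s⌋₊ ((σ m).ans (a.val s) (b.val s) (δ.val s)))
        (1 + e.cost s + i.cost s + a.cost s + b.cost s + δ.cost s +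
          (σ m).time (a.val s) (b.val s) (δ.val s))
  | seq {P Q : Program} {s s₁ s₂ : Store} {t₁ t₂ : ℕ} :
      Exec σ P s s₁ t₁ → Exec σ Q s₁ s₂ t₂ → Exec σ (.seq P Q) s s₂ (1 + t₁ + t₂)
  | ite_true {e : Expr} {P Q : Program} {s s₁ : Store} {t : ℕ} :
      0 < e.val s → Exec σ P s s₁ t → Exec σ (.ite e P Q) s s₁ (1 + e.cost s + t)
  | ite_false {e : Expr} {P Q : Program} {s s₁ : Store} {t : ℕ} :
      e.val s ≤ 0 → Exec σ Q s s₁ t → Exec σ (.ite e P Q) s s₁ (1 + e.cost s + t)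
  | loop_true {e : Expr} {P : Program} {s s₁ s₂ : Store} {t₁ t₂ : ℕ} :
      0 < e.val s → Exec σ P s s₁ t₁ → Exec σ (.loop e P) s₁ s₂ t₂ →
      Exec σ (.loop e P) s s₂ (1 + e.cost s + t₁ + t₂)
  | loop_false {e : Expr} {P : Program} {s : Store} :
      e.val s ≤ 0 → Exec σ (.loop e P) s s (1 + e.cost s)

/-- The initial memory: `n, k, α, γ` in array `0`, the costs in array `1`, zeros elsewhere. -/
def inputStore {n : ℕ} (I : Instance n) (γ : ℚ) : Store
  | 0, 0 => n
  | 0, 1 => I.k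
  | 0, 2 => I.α
  | 0, 3 => γ
  | 1, l => if h : l < n then I.c ⟨l, h⟩ else 0
  | _, _ => 0

/-- The memory holds the discrete instance `J`: `n, k, M` in array `2`, the grid in array `3`, the
probabilities, row by row, in array `4`, and the costs in array `5`. -/
structure Store.Holds {n : ℕ} (s : Store) (J : DiscreteInstance n) : Prop where
  n_eq : s 2 0 = n
  k_eq : s 2 1 = J.k
  M_eq : s 2 2 = J.M
  a_eq : ∀ j : Fin (J.M + 2), s 3 j = J.a j
  p_eq : ∀ (i : Fin n) (j : Fin (J.M + 2)), s 4 (i * (J.M + 2) + j) = J.p i j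
  c_eq : ∀ i : Fin n, s 5 i = J.c i

end

end ParetoCover

namespace ParetoCover

/-! ## The query coordinates -/

/-! Let `f` round every coordinate up to the grid `q_0 < ... < q_{M+1}`. The pushforward of `μ_i`
under rounding has mass `μ_i((q_{l-1}, q_l])` at `q_l`. The oracle answers and their sum are each
correct up to a factor `1 + ε`, so this pushforward and the `i`-th marginal of the discrete instance
dominate each other with constant `(1 + ε)^2`. By `pi_le_smul_pi` the product measure `ν` of the
discrete instance and the pushforward `f_* μ` dominate each other with constant `K = (1 + ε)^(2n)`.

Since `x ≤ f x`, a cover `B` of `ν` also covers `μ`, and its cost under `μ` is at most `K` times its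
cost under `ν` (`expectedCost_le_of_map_le`). Conversely, since `f` is monotone, a cover `B'` of `μ`
yields the cover `f(B')` of `ν`. Rounding a coordinate changes `b` to at most `ε α + (1 + ε) b`
(`queryCoord_succ_le`), and the additive error `ε α ∑ c_i` is at most `ε` times the cost of `B'`,
because the means are at least `α` (`le_expectedCost`). Hence the optimum for `ν` is at most `K (1 +
2ε)` times the optimum for `μ`. The losses multiply to `(1 + ε)^(4n) (1 + 2ε) (1 + γ/15) ≤ 1 + γ`
(`approximation_factor_le`).

The program needs no logarithm: `M` is the least `m` with `ε α (1 + ε)^m ≥ 1`, so it multiplies by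
`1 + ε` until the power reaches `1`. Then `M` is polynomial by Bernoulli's inequality
(`queryCount_le_mul`), and so are the lengths of the powers; the oracle answers are no longer than
the oracle time. Partial sums of answers stay short because their denominators divide a product of
denominators and their values are at most `2`. The predicate `Runs` separates the cost into a
constant of the program, a bound `b` on the handled numbers and the oracle times, and a bound `N` on
the iterations. -/

theorem queryCount_le_iff {ε α : ℚ} (hε : 0 < ε) (hα : 0 < α) (m : ℕ) :
    queryCount ε α ≤ m ↔ 1 ≤ ε * α * (1 + ε) ^ m := by
  have hε' : (0 : ℝ) < ε := by exact_mod_cast hε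
  have hα' : (0 : ℝ) < α := by exact_mod_cast hα
  have h : (0 : ℝ) < ε * α := mul_pos hε' hα'
  rw [queryCount, Nat.ceil_le, Real.logb_le_iff_le_rpow (by linarith) (inv_pos.2 h),
    Real.rpow_natCast, inv_le_iff_one_le_mul₀' h]
  exact_mod_cast Iff.rfl

theorem queryCoord_zero (ε α : ℚ) : queryCoord ε α 0 = 0 := rfl

theorem queryCoord_succ_of_lt {ε α : ℚ} {l : ℕ} (h : l < queryCount ε α) :
    queryCoord ε α (l + 1) = ε * α * (1 + ε) ^ l := by
  simp [queryCoord, Nat.succ_le_of_lt h]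

theorem queryCoord_of_lt {ε α : ℚ} {l : ℕ} (h : queryCount ε α < l) : queryCoord ε α l = 1 := by
  rw [queryCoord, if_neg (by omega), if_neg (by omega)]

theorem queryPrev_zero (ε α : ℚ) : queryPrev ε α 0 = -1 := rfl

theorem queryPrev_succ (ε α : ℚ) (l : ℕ) : queryPrev ε α (l + 1) = queryCoord ε α l := rfl

theorem queryCoord_lt_succ {ε α : ℚ} (hε : 0 < ε) (hα : 0 < α) {l : ℕ}
    (h : l ≤ queryCount ε α) : queryCoord ε α l < queryCoord ε α (l + 1) := by
  have hpos : 0 < ε * α := mul_pos hε hα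
  rcases l with _ | l
  · rw [queryCoord_zero]
    rcases Nat.eq_zero_or_pos (queryCount ε α) with h0 | h0
    · rw [queryCoord_of_lt (by omega)]; norm_num
    · rw [queryCoord_succ_of_lt h0]; positivity
  · rw [queryCoord_succ_of_lt (by omega)]
    rcases h.lt_or_eq with h1 | h1
    · rw [queryCoord_succ_of_lt h1, pow_succ, ← mul_assoc]
      exact lt_mul_of_one_lt_right (by positivity) (by linarith)
    · rw [queryCoord_of_lt (by omega)]
      -- If the power at `q_M` had already reached `1`, the exponent `M - 1` would contradict the
      -- minimality of `M`.
      by_contra! hc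
      have := (queryCount_le_iff hε hα l).2 hc
      omega

theorem queryCoord_lt_queryCoord {ε α : ℚ} (hε : 0 < ε) (hα : 0 < α) {l m : ℕ} (h : l < m)
    (hm : m ≤ queryCount ε α + 1) : queryCoord ε α l < queryCoord ε α m := by
  induction m, h using Nat.le_induction with
  | base => exact queryCoord_lt_succ hε hα (by omega)
  | succ m _ ih => exact (ih (by omega)).trans (queryCoord_lt_succ hε hα (by omega))

theorem queryCoord_le_one {ε α : ℚ} (hε : 0 < ε) (hα : 0 < α) (l : ℕ) :
    queryCoord ε α l ≤ 1 := by
  rcases le_or_gt l (queryCount ε α) with h | h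
  · rw [← queryCoord_of_lt (Nat.lt_succ_self (queryCount ε α))]
    exact (queryCoord_lt_queryCoord hε hα (Nat.lt_succ_of_le h) le_rfl).le
  · rw [queryCoord_of_lt h]

theorem queryCoord_nonneg {ε α : ℚ} (hε : 0 < ε) (hα : 0 < α) (l : ℕ) :
    0 ≤ queryCoord ε α l := by
  unfold queryCoord
  split_ifs <;> positivity

/-- The term `ε α` pays for the cell next to `0`, the factor `1 + ε` for the geometric cells; the
step from `q_M` to `1` is no longer than a geometric one, as `ε α (1 + ε)^M ≥ 1`. The case `M = 0`,
that is `ε α ≥ 1`, is not excluded here. -/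
theorem queryCoord_succ_le {ε α : ℚ} (hε : 0 < ε) (hα : 0 < α) (l : ℕ) :
    queryCoord ε α (l + 1) ≤ ε * α + (1 + ε) * queryCoord ε α l := by
  have hpos : 0 < ε * α := mul_pos hε hα
  rcases l with _ | l
  · rcases Nat.eq_zero_or_pos (queryCount ε α) with h0 | h0
    · have := (queryCount_le_iff hε hα 0).1 h0.le
      rw [queryCoord_zero, queryCoord_of_lt (by omega)]
      linarith
    · rw [queryCoord_succ_of_lt h0, queryCoord_zero]; simp
  · have hl := queryCoord_nonneg hε hα (l + 1)
    rcases lt_trichotomy (l + 1) (queryCount ε α) with h | h | h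
    · rw [queryCoord_succ_of_lt h, queryCoord_succ_of_lt (by omega), pow_succ]
      linarith
    · rw [queryCoord_of_lt (by omega), queryCoord_succ_of_lt (by omega)]
      have := (queryCount_le_iff hε hα (l + 1)).1 h.ge
      rw [pow_succ] at this
      linarith
    · rw [queryCoord_of_lt (by omega), queryCoord_of_lt (by omega)]
      linarith

theorem validQuery_queryCoord {ε α : ℚ} (hε : 0 < ε) (hε1 : ε < 1) (hα : 0 < α) {l : ℕ}
    (h : l ≤ queryCount ε α + 1) : ValidQuery (queryPrev ε α l) (queryCoord ε α l) ε := by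
  rcases l with _ | l
  · refine ⟨?_, ?_, ?_, hε, hε1⟩ <;> norm_num [queryPrev_zero, queryCoord_zero]
  · rw [queryPrev_succ]
    exact ⟨by linarith [queryCoord_nonneg hε hα l], queryCoord_lt_succ hε hα (by omega),
      queryCoord_le_one hε hα _, hε, hε1⟩

theorem accuracy_pos {n : ℕ} (hn : 1 ≤ n) {γ : ℚ} (hγ : 0 < γ) : 0 < accuracy n γ := by
  have : (0 : ℚ) < n := by exact_mod_cast hn
  have : 0 < min γ 1 := lt_min hγ one_pos
  unfold accuracy
  positivity

theorem accuracy_mul {n : ℕ} (hn : 1 ≤ n) (γ : ℚ) : accuracy n γ * (60 * n) = min γ 1 := by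
  have : (0 : ℚ) < n := by exact_mod_cast hn
  unfold accuracy
  field_simp

theorem accuracy_le {n : ℕ} (hn : 1 ≤ n) {γ : ℚ} (hγ : 0 < γ) : accuracy n γ ≤ 1 / 60 := by
  have h1 : (1 : ℚ) ≤ n := by exact_mod_cast hn
  have h2 := accuracy_mul hn γ
  have h3 := accuracy_pos hn hγ
  have h4 := min_le_right γ 1
  nlinarith

/-! ## The cells of the grid -/

/-- The points of the interval in `(a, b]`. -/
abbrev cell (a b : ℚ) : Set unitInterval := {x | (a : ℝ) < x ∧ (x : ℝ) ≤ b}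

theorem measurableSet_cell (a b : ℚ) : MeasurableSet (cell a b) :=
  (measurableSet_lt measurable_const measurable_subtype_coe).inter
    (measurableSet_le measurable_subtype_coe measurable_const)

/-- Consecutive half-open cells telescope to `(-1, 1]`. Starting at `-1` gives a possible atom at
`0` a cell of its own. -/
theorem sum_real_cell {ε α : ℚ} (hε : 0 < ε) (hα : 0 < α) (μ : Measure unitInterval)
    [IsProbabilityMeasure μ] :
    ∑ l ∈ Finset.range (queryCount ε α + 2),
      μ.real (cell (queryPrev ε α l) (queryCoord ε α l)) = 1 := by
  have key : ∀ m, m ≤ queryCount ε α + 1 → ∑ l ∈ Finset.range (m + 1),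
      μ.real (cell (queryPrev ε α l) (queryCoord ε α l)) =
        μ.real (cell (-1) (queryCoord ε α m)) := by
    intro m
    induction m with
    | zero => intro _; simp [queryPrev_zero]
    | succ m ih =>
      intro hm
      have h1 : ((queryCoord ε α m : ℚ) : ℝ) < queryCoord ε α (m + 1) := by
        exact_mod_cast queryCoord_lt_succ hε hα (by omega)
      have h2 : (0 : ℝ) ≤ queryCoord ε α m := by exact_mod_cast queryCoord_nonneg hε hα m
      rw [Finset.sum_range_succ, ih (by omega), ← measureReal_union _ (measurableSet_cell _ _)]
      · congr 1
        ext x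
        simp only [cell, queryPrev_succ, Set.mem_union, Set.mem_ofPred_eq]
        push_cast
        constructor
        · rintro (⟨h, h'⟩ | ⟨h, h'⟩) <;> constructor <;> linarith
        · rintro ⟨h, h'⟩
          rcases le_or_gt (x : ℝ) (queryCoord ε α m) with h3 | h3
          · exact Or.inl ⟨h, h3⟩
          · exact Or.inr ⟨h3, h'⟩
      · rw [Set.disjoint_left]
        rintro x ⟨_, hx⟩ ⟨hx', _⟩
        rw [queryPrev_succ] at hx'
        linarith
  rw [key _ le_rfl, queryCoord_of_lt (Nat.lt_succ_self _)]
  have : cell (-1) 1 = Set.univ := by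
    ext x
    have h0 := x.2.1
    have h1 := x.2.2
    simp only [cell, Set.mem_ofPred_eq, Set.mem_univ, iff_true]
    push_cast
    exact ⟨by linarith, h1⟩
  rw [this, probReal_univ]

/-! ## The oracle weights -/

section Weights

variable {σ : Oracle} {μ : Measure unitInterval} {ε α : ℚ}

theorem queryWeight_nonneg (h : σ.Approximates μ) (hε : 0 < ε) (hε1 : ε < 1) (hα : 0 < α)
    {l : ℕ} (hl : l ≤ queryCount ε α + 1) : 0 ≤ queryWeight σ ε α l :=
  (h _ _ _ (validQuery_queryCoord hε hε1 hα hl)).1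

theorem le_queryWeight (h : σ.Approximates μ) (hε : 0 < ε) (hε1 : ε < 1) (hα : 0 < α)
    {l : ℕ} (hl : l ≤ queryCount ε α + 1) :
    (1 + (ε : ℝ))⁻¹ * μ.real (cell (queryPrev ε α l) (queryCoord ε α l)) ≤
      queryWeight σ ε α l :=
  (h _ _ _ (validQuery_queryCoord hε hε1 hα hl)).2.1

theorem queryWeight_le (h : σ.Approximates μ) (hε : 0 < ε) (hε1 : ε < 1) (hα : 0 < α)
    {l : ℕ} (hl : l ≤ queryCount ε α + 1) :
    (queryWeight σ ε α l : ℝ) ≤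
      (1 + (ε : ℝ)) * μ.real (cell (queryPrev ε α l) (queryCoord ε α l)) :=
  (h _ _ _ (validQuery_queryCoord hε hε1 hα hl)).2.2

theorem sum_queryWeight_le [IsProbabilityMeasure μ] (h : σ.Approximates μ) (hε : 0 < ε)
    (hε1 : ε < 1) (hα : 0 < α) :
    ∑ l ∈ Finset.range (queryCount ε α + 2), queryWeight σ ε α l ≤ 1 + ε := by
  have : ∑ l ∈ Finset.range (queryCount ε α + 2), (queryWeight σ ε α l : ℝ) ≤ 1 + (ε : ℝ) := by
    calc _ ≤ ∑ l ∈ Finset.range (queryCount ε α + 2),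
          (1 + (ε : ℝ)) * μ.real (cell (queryPrev ε α l) (queryCoord ε α l)) :=
        Finset.sum_le_sum fun l hl => queryWeight_le h hε hε1 hα
          (Nat.le_of_lt_succ (Finset.mem_range.1 hl))
      _ = _ := by rw [← Finset.mul_sum, sum_real_cell hε hα μ, mul_one]
  exact_mod_cast this

theorem le_sum_queryWeight [IsProbabilityMeasure μ] (h : σ.Approximates μ) (hε : 0 < ε)
    (hε1 : ε < 1) (hα : 0 < α) :
    (1 + ε)⁻¹ ≤ ∑ l ∈ Finset.range (queryCount ε α + 2), queryWeight σ ε α l := by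
  have : (1 + (ε : ℝ))⁻¹ ≤ ∑ l ∈ Finset.range (queryCount ε α + 2), (queryWeight σ ε α l : ℝ) := by
    calc _ = ∑ l ∈ Finset.range (queryCount ε α + 2),
          (1 + (ε : ℝ))⁻¹ * μ.real (cell (queryPrev ε α l) (queryCoord ε α l)) := by
          rw [← Finset.mul_sum, sum_real_cell hε hα μ, mul_one]
      _ ≤ _ := Finset.sum_le_sum fun l hl => le_queryWeight h hε hε1 hα
          (Nat.le_of_lt_succ (Finset.mem_range.1 hl))
  exact_mod_cast this

theorem sum_queryWeight_pos [IsProbabilityMeasure μ] (h : σ.Approximates μ) (hε : 0 < ε)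
    (hε1 : ε < 1) (hα : 0 < α) :
    0 < ∑ l ∈ Finset.range (queryCount ε α + 2), queryWeight σ ε α l :=
  lt_of_lt_of_le (by positivity) (le_sum_queryWeight h hε hε1 hα)

/-- The normalized oracle answers. -/
noncomputable def queryProb (σ : Oracle) (ε α : ℚ) (l : ℕ) : ℚ :=
  queryWeight σ ε α l / ∑ t ∈ Finset.range (queryCount ε α + 2), queryWeight σ ε α t

/-- One factor `1 + ε` comes from the answer, the other from the normalizing sum, which is at least
`(1 + ε)⁻¹`. -/
theorem queryProb_le [IsProbabilityMeasure μ] (h : σ.Approximates μ) (hε : 0 < ε)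
    (hε1 : ε < 1) (hα : 0 < α) {l : ℕ} (hl : l ≤ queryCount ε α + 1) :
    (queryProb σ ε α l : ℝ) ≤
      (1 + (ε : ℝ)) ^ 2 * μ.real (cell (queryPrev ε α l) (queryCoord ε α l)) := by
  have hε' : (0 : ℝ) < ε := by exact_mod_cast hε
  have h1 : (1 + (ε : ℝ))⁻¹ ≤ ((∑ l ∈ Finset.range (queryCount ε α + 2),
      queryWeight σ ε α l : ℚ) : ℝ) := by
    exact_mod_cast le_sum_queryWeight h hε hε1 hα
  have h2 := queryWeight_le h hε hε1 hα hl
  have h3 : (0 : ℝ) ≤ μ.real (cell (queryPrev ε α l) (queryCoord ε α l)) := measureReal_nonneg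
  rw [queryProb, Rat.cast_div, div_le_iff₀ (lt_of_lt_of_le (by positivity) h1)]
  calc (queryWeight σ ε α l : ℝ)
      ≤ (1 + (ε : ℝ)) * μ.real (cell (queryPrev ε α l) (queryCoord ε α l)) := h2
    _ = (1 + (ε : ℝ)) ^ 2 * μ.real (cell (queryPrev ε α l) (queryCoord ε α l)) *
          (1 + (ε : ℝ))⁻¹ := by field_simp
    _ ≤ _ := by gcongr

theorem le_queryProb [IsProbabilityMeasure μ] (h : σ.Approximates μ) (hε : 0 < ε)
    (hε1 : ε < 1) (hα : 0 < α) {l : ℕ} (hl : l ≤ queryCount ε α + 1) :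
    μ.real (cell (queryPrev ε α l) (queryCoord ε α l)) ≤
      (1 + (ε : ℝ)) ^ 2 * queryProb σ ε α l := by
  have hε' : (0 : ℝ) < ε := by exact_mod_cast hε
  have h1 : ((∑ l ∈ Finset.range (queryCount ε α + 2), queryWeight σ ε α l : ℚ) : ℝ) ≤
      1 + (ε : ℝ) := by
    exact_mod_cast sum_queryWeight_le h hε hε1 hα
  have h0 : (0 : ℝ) < ((∑ l ∈ Finset.range (queryCount ε α + 2),
      queryWeight σ ε α l : ℚ) : ℝ) := by
    exact_mod_cast sum_queryWeight_pos h hε hε1 hα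
  have h2 := le_queryWeight h hε hε1 hα hl
  have h3 : (0 : ℝ) ≤ μ.real (cell (queryPrev ε α l) (queryCoord ε α l)) := measureReal_nonneg
  rw [queryProb, Rat.cast_div, ← mul_div_assoc, le_div_iff₀ h0]
  calc μ.real (cell (queryPrev ε α l) (queryCoord ε α l)) * _
      ≤ μ.real (cell (queryPrev ε α l) (queryCoord ε α l)) * (1 + (ε : ℝ)) := by gcongr
    _ = (1 + (ε : ℝ)) ^ 2 * ((1 + (ε : ℝ))⁻¹ *
          μ.real (cell (queryPrev ε α l) (queryCoord ε α l))) := by field_simp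
    _ ≤ _ := by gcongr

theorem queryProb_mem [IsProbabilityMeasure μ] (h : σ.Approximates μ) (hε : 0 < ε)
    (hε1 : ε < 1) (hα : 0 < α) {l : ℕ} (hl : l ≤ queryCount ε α + 1) :
    queryProb σ ε α l ∈ Set.Icc (0 : ℚ) 1 := by
  have hw : ∀ t ∈ Finset.range (queryCount ε α + 2), 0 ≤ queryWeight σ ε α t := fun t ht =>
    queryWeight_nonneg h hε hε1 hα (by have := Finset.mem_range.1 ht; omega)
  have hl' : l ∈ Finset.range (queryCount ε α + 2) := Finset.mem_range.2 (by omega)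
  exact ⟨div_nonneg (hw l hl') (Finset.sum_nonneg hw),
    div_le_one_of_le₀ (Finset.single_le_sum hw hl') (Finset.sum_nonneg hw)⟩

theorem sum_queryProb [IsProbabilityMeasure μ] (h : σ.Approximates μ) (hε : 0 < ε)
    (hε1 : ε < 1) (hα : 0 < α) :
    ∑ l ∈ Finset.range (queryCount ε α + 2), queryProb σ ε α l = 1 := by
  unfold queryProb
  rw [← Finset.sum_div, div_self (sum_queryWeight_pos h hε hε1 hα).ne']

end Weights

/-- The discrete instance with the query coordinates as grid and the normalized oracle answers as
probabilities. -/
noncomputable def reducedInstance {n : ℕ} (I : Instance n) (hn : 1 ≤ n) {γ : ℚ} (hγ : 0 < γ) :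
    DiscreteInstance n where
  M := queryCount (accuracy n γ) I.α
  a j := queryCoord (accuracy n γ) I.α j
  a_strictMono i j h := queryCoord_lt_queryCoord (accuracy_pos hn hγ) I.α_pos h (by omega)
  a_zero := queryCoord_zero _ _
  a_last := queryCoord_of_lt (by simp)
  p i j := queryProb (I.oracle i) (accuracy n γ) I.α j
  p_mem i j := by
    have := I.isProb i
    exact queryProb_mem (I.nice i).1 (accuracy_pos hn hγ)
      ((accuracy_le hn hγ).trans_lt (by norm_num)) I.α_pos (by omega)
  p_sum i := by
    have := I.isProb i
    rw [Fin.sum_univ_eq_sum_range (fun j => queryProb (I.oracle i) (accuracy n γ) I.α j)]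
    exact sum_queryProb (I.nice i).1 (accuracy_pos hn hγ)
      ((accuracy_le hn hγ).trans_lt (by norm_num)) I.α_pos
  c := I.c
  c_nonneg := I.c_nonneg
  k := I.k
  one_le_k := I.one_le_k

theorem isReducedInstance_reducedInstance {n : ℕ} (I : Instance n) (hn : 1 ≤ n) {γ : ℚ}
    (hγ : 0 < γ) : IsReducedInstance I γ (reducedInstance I hn hγ) :=
  ⟨rfl, rfl, rfl, fun _ => rfl, fun _ _ => rfl⟩

/-! ## Domination of product measures -/

/-- `OuterMeasure.pi` is the largest outer measure that is bounded on boxes by the product of the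
side measures, and after scaling by `C⁻ⁿ` the product of the `ν i` satisfies this bound. So
comparing boxes suffices for an inequality of measures. -/
theorem pi_le_smul_pi {ι X : Type*} [Fintype ι] [MeasurableSpace X] {μ ν : ι → Measure X}
    [∀ i, IsFiniteMeasure (μ i)] [∀ i, IsFiniteMeasure (ν i)] {C : ℝ≥0∞} (hC0 : C ≠ 0)
    (hC : C ≠ ∞) (h : ∀ i, ν i ≤ C • μ i) :
    Measure.pi ν ≤ C ^ Fintype.card ι • Measure.pi μ := by
  have h1 : (C ^ Fintype.card ι)⁻¹ • (Measure.pi ν).toOuterMeasure ≤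
      OuterMeasure.pi fun i => (μ i).toOuterMeasure := by
    rw [OuterMeasure.le_pi]
    intro s _
    change (C ^ Fintype.card ι)⁻¹ * Measure.pi ν (Set.univ.pi s) ≤ ∏ i, μ i (s i)
    rw [Measure.pi_pi, ENNReal.inv_mul_le_iff (by positivity) (by finiteness),
      ← Finset.card_univ, Finset.pow_card_mul_prod]
    exact Finset.prod_le_prod' fun i _ => h i (s i)
  refine Measure.le_iff.2 fun s hs => ?_
  have h2 := (h1 s).trans (le_toMeasure_apply _ (Measure.pi_caratheodory _) s)
  have h3 : Measure.pi μ s = (OuterMeasure.pi fun i => (μ i).toOuterMeasure).toMeasure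
      (Measure.pi_caratheodory _) s := by
    rw [Measure.pi]
  rw [← h3] at h2
  change (C ^ Fintype.card ι)⁻¹ * Measure.pi ν s ≤ _ at h2
  rwa [ENNReal.inv_mul_le_iff (by positivity) (by finiteness)] at h2

/-! ## Rounding up to the grid -/

namespace DiscreteInstance

variable {n : ℕ} (J : DiscreteInstance n)

/-- The grid points, as points of the unit interval. -/
def gridPoint (j : Fin (J.M + 2)) : unitInterval := ⟨(J.a j : ℝ), J.a_mem j⟩

theorem gridPoint_strictMono : StrictMono J.gridPoint := fun i j h => by
  have := J.a_strictMono h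
  exact Subtype.mk_lt_mk.2 (by exact_mod_cast this)

theorem exists_le_gridPoint (x : unitInterval) :
    (Finset.univ.filter fun j => x ≤ J.gridPoint j).Nonempty := by
  refine ⟨Fin.last (J.M + 1), Finset.mem_filter.2 ⟨Finset.mem_univ _, ?_⟩⟩
  refine Subtype.coe_le_coe.1 ?_
  simpa [gridPoint, J.a_last] using x.2.2

/-- The index of the least grid point above `x`. -/
noncomputable def roundIndex (x : unitInterval) : Fin (J.M + 2) :=
  (Finset.univ.filter fun j => x ≤ J.gridPoint j).min' (J.exists_le_gridPoint x)

/-- The least grid point above `x`. -/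
noncomputable def roundUp (x : unitInterval) : unitInterval := J.gridPoint (J.roundIndex x)

theorem le_roundUp (x : unitInterval) : x ≤ J.roundUp x :=
  (Finset.mem_filter.1 (Finset.min'_mem _ (J.exists_le_gridPoint x))).2

/-- A Galois connection: monotonicity of rounding and the shape of its fibres both follow from it.
-/
theorem roundIndex_le_iff (x : unitInterval) (j : Fin (J.M + 2)) :
    J.roundIndex x ≤ j ↔ x ≤ J.gridPoint j :=
  ⟨fun h => (J.le_roundUp x).trans (J.gridPoint_strictMono.monotone h), fun h =>
    Finset.min'_le _ j (Finset.mem_filter.2 ⟨Finset.mem_univ j, h⟩)⟩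

theorem roundIndex_mono : Monotone J.roundIndex := fun _ y h =>
  (J.roundIndex_le_iff _ _).2 (h.trans (J.le_roundUp y))

theorem roundUp_mono : Monotone J.roundUp := fun _ _ h =>
  J.gridPoint_strictMono.monotone (J.roundIndex_mono h)

theorem measurable_roundUp : Measurable J.roundUp := J.roundUp_mono.measurable

/-- Rounding factors through the finite index type, on which every measure is a combination of point
masses. -/
theorem map_roundUp (μ : Measure unitInterval) :
    μ.map J.roundUp =
      ∑ j, μ (J.roundIndex ⁻¹' {j}) • Measure.dirac (J.gridPoint j) := by
  have hi : Measurable J.roundIndex := J.roundIndex_mono.measurable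
  have hg : Measurable J.gridPoint := measurable_of_countable _
  ext s hs
  have h1 : μ.map J.roundUp s = μ.map J.roundIndex (J.gridPoint ⁻¹' s) := by
    rw [Measure.map_apply hi (hg hs), Measure.map_apply J.measurable_roundUp hs]
    rfl
  rw [h1, ← Measure.sum_smul_dirac (μ.map J.roundIndex), Measure.sum_fintype]
  simp only [Measure.finsetSum_apply, Measure.smul_apply, smul_eq_mul,
    Measure.dirac_apply' _ hs, Measure.dirac_apply' _ (hg hs),
    Measure.map_apply hi (measurableSet_singleton _)]
  rfl

theorem marginal_apply (i : Fin n) (s : Set unitInterval) :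
    J.marginal i s =
      ∑ j, ENNReal.ofReal (J.p i j) * Measure.dirac (J.gridPoint j) s := by
  simp only [marginal, Measure.finsetSum_apply, Measure.smul_apply, smul_eq_mul]
  rfl

instance (i : Fin n) : IsProbabilityMeasure (J.marginal i) := ⟨by
  rw [marginal_apply]
  simp only [measure_univ, mul_one]
  rw [← ENNReal.ofReal_sum_of_nonneg fun j _ => by exact_mod_cast (J.p_mem i j).1]
  have := J.p_sum i
  rw [← ENNReal.ofReal_one]
  congr 1
  exact_mod_cast this⟩

instance : IsProbabilityMeasure J.measure := by
  unfold measure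
  infer_instance

/-- Both measures are combinations of the same point masses, so coefficients can be compared. -/
theorem marginal_le {μ : Measure unitInterval} {i : Fin n} {C : ℝ≥0∞}
    (h : ∀ j, ENNReal.ofReal (J.p i j) ≤ C * μ (J.roundIndex ⁻¹' {j})) :
    J.marginal i ≤ C • μ.map J.roundUp := by
  refine Measure.le_iff.2 fun s _ => ?_
  rw [marginal_apply, map_roundUp, Measure.smul_apply, Measure.finsetSum_apply, smul_eq_mul,
    Finset.mul_sum]
  refine Finset.sum_le_sum fun j _ => ?_
  rw [Measure.smul_apply, smul_eq_mul, ← mul_assoc]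
  gcongr
  exact h j

theorem map_roundUp_le {μ : Measure unitInterval} {i : Fin n} {C : ℝ≥0∞}
    (h : ∀ j, μ (J.roundIndex ⁻¹' {j}) ≤ C * ENNReal.ofReal (J.p i j)) :
    μ.map J.roundUp ≤ C • J.marginal i := by
  refine Measure.le_iff.2 fun s _ => ?_
  rw [Measure.smul_apply, marginal_apply, map_roundUp, Measure.finsetSum_apply, smul_eq_mul,
    Finset.mul_sum]
  refine Finset.sum_le_sum fun j _ => ?_
  rw [Measure.smul_apply, smul_eq_mul, ← mul_assoc]
  gcongr
  exact h j

/-- Rounding up in every coordinate. -/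
noncomputable def roundVec (x : Fin n → unitInterval) : Fin n → unitInterval :=
  fun i => J.roundUp (x i)

theorem le_roundVec (x : Fin n → unitInterval) : x ≤ J.roundVec x := fun i => J.le_roundUp (x i)

theorem roundVec_mono : Monotone J.roundVec := fun _ _ h i => J.roundUp_mono (h i)

theorem measurable_roundVec : Measurable J.roundVec :=
  measurable_pi_lambda _ fun i => J.measurable_roundUp.comp (measurable_pi_apply i)

theorem map_roundVec (μ : Fin n → Measure unitInterval) [∀ i, IsProbabilityMeasure (μ i)] :
    (Measure.pi μ).map J.roundVec = Measure.pi fun i => (μ i).map J.roundUp := by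
  have : ∀ i, IsProbabilityMeasure ((μ i).map J.roundUp) := fun i =>
    Measure.isProbabilityMeasure_map J.measurable_roundUp.aemeasurable
  exact Measure.pi_map_pi fun i => J.measurable_roundUp.aemeasurable

end DiscreteInstance

/-! ## Covers and their costs -/

section Covers

variable {n : ℕ} {c : Fin n → ℚ} {B B' : Finset (Fin n → unitInterval)}
  {x b : Fin n → unitInterval}

theorem coverCost_le (hb : b ∈ B) (hx : x ≤ b) :
    coverCost c B x ≤ ENNReal.ofReal (∑ i, (c i : ℝ) * (b i : ℝ)) :=
  (iInf₂_le b hb).trans (iInf_le _ hx)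

theorem coverCost_eq_top_or (c : Fin n → ℚ) (B : Finset (Fin n → unitInterval))
    (x : Fin n → unitInterval) : coverCost c B x = ∞ ∨
      ∃ b ∈ B, x ≤ b ∧ coverCost c B x = ENNReal.ofReal (∑ i, (c i : ℝ) * (b i : ℝ)) := by
  classical
  have h : coverCost c B x =
      (B.filter (x ≤ ·)).inf fun b => ENNReal.ofReal (∑ i, (c i : ℝ) * (b i : ℝ)) := by
    rw [coverCost, Finset.inf_eq_iInf]
    simp only [Finset.mem_filter, iInf_and]
  rcases (B.filter (x ≤ ·)).eq_empty_or_nonempty with h0 | h0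
  · left
    rw [h, h0, Finset.inf_empty]
  · obtain ⟨b, hb, hb'⟩ := Finset.exists_mem_eq_inf _ h0
      fun b : Fin n → unitInterval => ENNReal.ofReal (∑ i, (c i : ℝ) * (b i : ℝ))
    rw [Finset.mem_filter] at hb
    exact Or.inr ⟨b, hb.1, hb.2, h.trans hb'⟩

theorem coverCost_anti_left (h : B ⊆ B') (x : Fin n → unitInterval) :
    coverCost c B' x ≤ coverCost c B x :=
  le_iInf₂ fun _ hb => le_iInf fun hx => coverCost_le (h hb) hx

theorem coverCost_mono (c : Fin n → ℚ) (B : Finset (Fin n → unitInterval)) :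
    Monotone (coverCost c B) := fun _ _ h =>
  le_iInf₂ fun _ hb => le_iInf fun hx => coverCost_le hb (h.trans hx)

theorem measurable_coverCost (c : Fin n → ℚ) (B : Finset (Fin n → unitInterval)) :
    Measurable (coverCost c B) := by
  classical
  have : coverCost c B = fun x => ⨅ b ∈ B,
      if x ≤ b then ENNReal.ofReal (∑ i, (c i : ℝ) * (b i : ℝ)) else ∞ := by
    funext x
    simp only [coverCost, iInf_eq_if]
  rw [this]
  refine Measurable.biInf _ B.countable_toSet fun b _ => ?_
  exact Measurable.ite measurableSet_Iic measurable_const measurable_const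

theorem measurableSet_covered (B : Finset (Fin n → unitInterval)) :
    MeasurableSet {x | ∃ b ∈ B, x ≤ b} := by
  have : {x | ∃ b ∈ B, x ≤ b} = ⋃ b ∈ B, Set.Iic b := by
    ext x
    simp
  rw [this]
  exact B.measurableSet_biUnion fun b _ => measurableSet_Iic

theorem isParetoCover_iff {μ : Measure (Fin n → unitInterval)} [IsProbabilityMeasure μ] :
    IsParetoCover μ B ↔ μ {x | ∃ b ∈ B, x ≤ b}ᶜ = 0 :=
  (prob_compl_eq_zero_iff (measurableSet_covered B)).symm

/-- In positive dimension, a cover by at most `k` points can be padded to `k` points. -/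
theorem exists_isSolution_superset (hn : 1 ≤ n) {μ : Measure (Fin n → unitInterval)}
    [IsProbabilityMeasure μ] {k : ℕ} (hB : IsParetoCover μ B) (hk : B.card ≤ k) :
    ∃ B', B ⊆ B' ∧ IsSolution μ k B' := by
  -- Positive dimension makes the cube infinite; in dimension `0` it is a single point and cannot be
  -- padded.
  have : Nonempty (Fin n) := ⟨⟨0, hn⟩⟩
  have : Infinite unitInterval := (Set.Icc_infinite zero_lt_one).to_subtype
  have : Infinite (Fin n → unitInterval) := Pi.infinite_of_right
  obtain ⟨B', h, hc⟩ := Infinite.exists_superset_card_eq B k hk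
  refine ⟨B', h, hc, le_antisymm prob_le_one ?_⟩
  rw [← hB]
  exact measure_mono fun x ⟨b, hb, hx⟩ => ⟨b, h hb, hx⟩

theorem le_coverCost (hc : ∀ i, 0 ≤ c i) (B : Finset (Fin n → unitInterval))
    (x : Fin n → unitInterval) :
    ENNReal.ofReal (∑ i, (c i : ℝ) * (x i : ℝ)) ≤ coverCost c B x := by
  refine le_iInf₂ fun b _ => le_iInf fun hx => ENNReal.ofReal_le_ofReal ?_
  refine Finset.sum_le_sum fun i _ => mul_le_mul_of_nonneg_left (hx i) ?_
  exact_mod_cast hc i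

/-- Integrate `c · x ≤ c_B(x)` coordinate by coordinate. This bound later converts the additive
rounding error into a multiplicative one. -/
theorem le_expectedCost (hc : ∀ i, 0 ≤ c i) {μ : Fin n → Measure unitInterval}
    [∀ i, IsProbabilityMeasure (μ i)] {α : ℚ} (hα : ∀ i, (α : ℝ) ≤ ∫ x, (x : ℝ) ∂(μ i))
    (B : Finset (Fin n → unitInterval)) :
    ENNReal.ofReal (α * ∑ i, (c i : ℝ)) ≤ expectedCost (Measure.pi μ) c B := by
  have hc' : ∀ i, (0 : ℝ) ≤ c i := fun i => by exact_mod_cast hc i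
  have hint : ∀ i, Integrable (fun x : Fin n → unitInterval => (x i : ℝ)) (Measure.pi μ) := by
    intro i
    refine Integrable.of_bound (C := 1)
      (measurable_subtype_coe.comp (measurable_pi_apply i)).aestronglyMeasurable ?_
    refine Filter.Eventually.of_forall fun x => ?_
    rw [Real.norm_eq_abs, abs_of_nonneg (x i).2.1]
    exact (x i).2.2
  refine le_trans ?_ (lintegral_mono (le_coverCost hc B))
  rw [← ofReal_integral_eq_lintegral_ofReal
    (integrable_finsetSum _ fun i _ => (hint i).const_mul _)
    (Filter.Eventually.of_forall fun x =>
      Finset.sum_nonneg fun i _ => mul_nonneg (hc' i) (x i).2.1)]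
  refine ENNReal.ofReal_le_ofReal ?_
  rw [integral_finsetSum _ fun i _ => (hint i).const_mul _, Finset.mul_sum]
  refine Finset.sum_le_sum fun i _ => ?_
  rw [integral_const_mul, mul_comm]
  refine mul_le_mul_of_nonneg_left ((hα i).trans_eq ?_) (hc' i)
  have h := (measurePreserving_eval μ i).map_eq
  conv_lhs => rw [← h]
  rw [integral_map (measurable_pi_apply i).aemeasurable
    measurable_subtype_coe.aestronglyMeasurable]

/-! ## Transfer of solutions -/

/-- `coverCost` is monotone in the point, so moving points upward cannot lower the cost. -/
theorem expectedCost_le_of_map_le {μ ν : Measure (Fin n → unitInterval)} {K : ℝ≥0∞}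
    {f : (Fin n → unitInterval) → Fin n → unitInterval} (hf : Measurable f) (hle : ∀ x, x ≤ f x)
    (h : μ.map f ≤ K • ν) : expectedCost μ c B ≤ K * expectedCost ν c B := by
  calc expectedCost μ c B ≤ ∫⁻ x, coverCost c B (f x) ∂μ :=
        lintegral_mono fun x => coverCost_mono c B (hle x)
    _ = ∫⁻ x, coverCost c B x ∂(μ.map f) := (lintegral_map (measurable_coverCost c B) hf).symm
    _ ≤ ∫⁻ x, coverCost c B x ∂(K • ν) := lintegral_mono' h le_rfl
    _ = K * expectedCost ν c B := by rw [lintegral_smul_measure]; rfl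

variable {μ ν : Measure (Fin n → unitInterval)} [IsProbabilityMeasure μ]
  [IsProbabilityMeasure ν] {K : ℝ≥0∞} {f : (Fin n → unitInterval) → Fin n → unitInterval} {k : ℕ}

theorem IsSolution.of_map_le (hf : Measurable f) (hle : ∀ x, x ≤ f x)
    (h : μ.map f ≤ K • ν) (hB : IsSolution ν k B) : IsSolution μ k B := by
  refine ⟨hB.1, isParetoCover_iff.2 (le_antisymm ?_ zero_le)⟩
  have h0 := h {x | ∃ b ∈ B, x ≤ b}ᶜ
  rw [Measure.smul_apply, isParetoCover_iff.1 hB.2, smul_zero,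
    Measure.map_apply hf (measurableSet_covered B).compl] at h0
  refine (measure_mono fun x hx => ?_).trans h0
  rintro ⟨b, hb, hxb⟩
  exact hx ⟨b, hb, (hle x).trans hxb⟩

/-- The witness is the image of `B` under `f`: monotonicity turns `x ≤ b` into `f x ≤ f b`, and the
cost of `f b` exceeds that of `b` in a controlled way. -/
theorem exists_isSolution_of_le_map (hn : 1 ≤ n) (hf : Measurable f) (hmono : Monotone f)
    (h : ν ≤ K • μ.map f) (hB : IsSolution μ k B) {r s : ℝ} (hr : 0 < r) (hs : 0 ≤ s)
    (hc : ∀ i, 0 ≤ c i)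
    (hrs : ∀ b : Fin n → unitInterval, ∀ i, (f b i : ℝ) ≤ s + r * b i) :
    ∃ B', IsSolution ν k B' ∧ expectedCost ν c B' ≤
      K * (ENNReal.ofReal (s * ∑ i, (c i : ℝ)) + ENNReal.ofReal r * expectedCost μ c B) := by
  classical
  have hc' : ∀ i, (0 : ℝ) ≤ c i := fun i => by exact_mod_cast hc i
  have hcov : IsParetoCover ν (B.image f) := by
    refine isParetoCover_iff.2 (le_antisymm ((h _).trans ?_) zero_le)
    rw [Measure.smul_apply, Measure.map_apply hf (measurableSet_covered _).compl]
    have : μ (f ⁻¹' {x | ∃ b ∈ B.image f, x ≤ b}ᶜ) ≤ 0 := by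
      rw [← isParetoCover_iff.1 hB.2]
      refine measure_mono fun x hx => ?_
      rintro ⟨b, hb, hxb⟩
      exact hx ⟨f b, Finset.mem_image_of_mem f hb, hmono hxb⟩
    rw [le_antisymm this zero_le, smul_zero]
  -- Points of `B` may collide under `f`; the added points never raise the cost.
  obtain ⟨B', hB', hsol⟩ := exists_isSolution_superset hn hcov
    (Finset.card_image_le.trans hB.1.le)
  refine ⟨B', hsol, ?_⟩
  calc expectedCost ν c B' ≤ ∫⁻ x, coverCost c (B.image f) x ∂(K • μ.map f) :=
        lintegral_mono' h fun x => coverCost_anti_left hB' x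
    _ = K * ∫⁻ x, coverCost c (B.image f) (f x) ∂μ := by
        rw [lintegral_smul_measure, lintegral_map (measurable_coverCost c _) hf]
        rfl
    _ ≤ K * ∫⁻ x, (ENNReal.ofReal (s * ∑ i, (c i : ℝ)) +
          ENNReal.ofReal r * coverCost c B x) ∂μ := by
        gcongr with x
        -- At uncovered points the right side is infinite because `r > 0`; elsewhere a cheapest `b`
        -- above `x` exists.
        rcases coverCost_eq_top_or c B x with htop | ⟨b, hb, hxb, heq⟩
        · rw [htop, ENNReal.mul_top (by simpa using hr), add_top]
          exact le_top
        · refine (coverCost_le (Finset.mem_image_of_mem f hb) (hmono hxb)).trans ?_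
          rw [heq, ← ENNReal.ofReal_mul hr.le, ← ENNReal.ofReal_add
            (mul_nonneg hs (Finset.sum_nonneg fun i _ => hc' i))
            (mul_nonneg hr.le (Finset.sum_nonneg fun i _ => mul_nonneg (hc' i) (b i).2.1))]
          refine ENNReal.ofReal_le_ofReal ?_
          rw [Finset.mul_sum, Finset.mul_sum, ← Finset.sum_add_distrib]
          refine Finset.sum_le_sum fun i _ => ?_
          have := mul_le_mul_of_nonneg_left (hrs b i) (hc' i)
          linarith
    _ = _ := by
        rw [lintegral_add_left measurable_const, lintegral_const, measure_univ, mul_one,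
          lintegral_const_mul _ (measurable_coverCost c B)]
        rfl

end Covers

/-! ## The reduced instance approximates the original one -/

/-- With `g = min γ 1 = 60 n ε`, the `4n` factors `1 + ε` are at most `exp(4nε) = exp(g/15) ≤ 1/(1 -
g/15)`, and `2ε ≤ g/30`. What remains is `(1 + γ/15)(1 + g/30) ≤ (1 + γ)(1 - g/15)`, which follows
from `g ≤ γ` and `g ≤ 1`. -/
theorem approximation_factor_le {n : ℕ} (hn : 1 ≤ n) {γ : ℚ} (hγ : 0 < γ) :
    ((1 + (accuracy n γ : ℝ)) ^ 2) ^ n * (1 + (γ : ℝ) / 15) *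
      (((1 + (accuracy n γ : ℝ)) ^ 2) ^ n * (1 + 2 * (accuracy n γ : ℝ))) ≤ 1 + γ := by
  have hε' : (0 : ℝ) < accuracy n γ := by exact_mod_cast accuracy_pos hn hγ
  have hγ' : (0 : ℝ) < γ := by exact_mod_cast hγ
  have hn' : (1 : ℝ) ≤ n := by exact_mod_cast hn
  obtain ⟨g, hg⟩ : ∃ g : ℝ, g = ((min γ 1 : ℚ) : ℝ) := ⟨_, rfl⟩
  have hgγ : g ≤ γ := by rw [hg]; exact_mod_cast min_le_left γ 1
  have hg1 : g ≤ 1 := by rw [hg]; exact_mod_cast min_le_right γ 1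
  have hεg : (accuracy n γ : ℝ) * (60 * n) = g := by rw [hg]; exact_mod_cast accuracy_mul hn γ
  have hg0 : 0 < g := by rw [← hεg]; positivity
  have hεle : 2 * (accuracy n γ : ℝ) ≤ g / 30 := by nlinarith
  have hpow : ((1 + (accuracy n γ : ℝ)) ^ 2) ^ n * ((1 + (accuracy n γ : ℝ)) ^ 2) ^ n ≤
      1 / (1 - g / 15) := by
    refine le_trans ?_ (Real.exp_bound_div_one_sub_of_interval (by positivity) (by linarith))
    have h1 : 1 + (accuracy n γ : ℝ) ≤ Real.exp (accuracy n γ) := by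
      linarith [Real.add_one_le_exp (accuracy n γ : ℝ)]
    calc ((1 + (accuracy n γ : ℝ)) ^ 2) ^ n * ((1 + (accuracy n γ : ℝ)) ^ 2) ^ n
        = (1 + (accuracy n γ : ℝ)) ^ (4 * n) := by
          rw [← pow_mul, ← pow_add]
          ring_nf
      _ ≤ Real.exp (accuracy n γ) ^ (4 * n) := by gcongr
      _ = Real.exp (g / 15) := by
        rw [← Real.exp_nat_mul]
        congr 1
        push_cast
        linarith
  calc ((1 + (accuracy n γ : ℝ)) ^ 2) ^ n * (1 + (γ : ℝ) / 15) *
        (((1 + (accuracy n γ : ℝ)) ^ 2) ^ n * (1 + 2 * (accuracy n γ : ℝ)))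
      = (((1 + (accuracy n γ : ℝ)) ^ 2) ^ n * ((1 + (accuracy n γ : ℝ)) ^ 2) ^ n) *
          ((1 + (γ : ℝ) / 15) * (1 + 2 * (accuracy n γ : ℝ))) := by ring
    _ ≤ 1 / (1 - g / 15) * ((1 + (γ : ℝ) / 15) * (1 + g / 30)) := by
      gcongr
      exact one_div_nonneg.2 (by linarith)
    _ ≤ 1 + γ := by
      rw [one_div_mul_eq_div, div_le_iff₀ (by linarith)]
      nlinarith [mul_le_mul_of_nonneg_left hg1 hγ'.le]

section Reduced

variable {n : ℕ} (I : Instance n) (hn : 1 ≤ n) {γ : ℚ} (hγ : 0 < γ)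

/-- Index `l` is chosen iff `x ≤ q_l` but not `x ≤ q_{l-1}`; for `l = 0` the second condition is
void, matching `q_{-1} = -1`. -/
theorem roundIndex_reducedInstance_preimage
    (j : Fin ((reducedInstance I hn hγ).M + 2)) :
    (reducedInstance I hn hγ).roundIndex ⁻¹' {j} =
      cell (queryPrev (accuracy n γ) I.α j) (queryCoord (accuracy n γ) I.α j) := by
  have hle : ∀ (x : unitInterval) (j : Fin ((reducedInstance I hn hγ).M + 2)),
      (reducedInstance I hn hγ).roundIndex x ≤ j ↔
        (x : ℝ) ≤ queryCoord (accuracy n γ) I.α j :=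
    fun x j => (reducedInstance I hn hγ).roundIndex_le_iff x j
  ext x
  rw [Set.mem_preimage, Set.mem_singleton_iff, le_antisymm_iff, hle, and_comm]
  refine and_congr_left fun _ => ?_
  rcases j with ⟨l, hl⟩
  rcases l with _ | l
  · have := x.2.1
    refine iff_of_true (Fin.zero_le _) ?_
    rw [queryPrev_zero]
    push_cast
    linarith
  · have h := hle x ⟨l, Nat.lt_of_succ_lt hl⟩
    rw [queryPrev_succ, ← not_le, ← h, not_le, Fin.lt_def, Fin.le_def]
    exact Nat.succ_le_iff

theorem roundUp_reducedInstance_le (x : unitInterval) :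
    ((reducedInstance I hn hγ).roundUp x : ℝ) ≤
      (accuracy n γ : ℝ) * I.α + (1 + (accuracy n γ : ℝ)) * x := by
  have hε := accuracy_pos hn hγ
  have hx : x ∈ (reducedInstance I hn hγ).roundIndex ⁻¹'
    {(reducedInstance I hn hγ).roundIndex x} := rfl
  rw [roundIndex_reducedInstance_preimage] at hx
  have hε' : (0 : ℝ) < accuracy n γ := by exact_mod_cast hε
  have hα' : (0 : ℝ) < I.α := by exact_mod_cast I.α_pos
  have hx0 := x.2.1
  change ((queryCoord (accuracy n γ) I.α ((reducedInstance I hn hγ).roundIndex x) : ℚ) : ℝ) ≤ _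
  rcases h : ((reducedInstance I hn hγ).roundIndex x : ℕ) with _ | l
  · rw [queryCoord_zero]
    push_cast
    positivity
  · rw [h, queryPrev_succ] at hx
    have h1 : ((queryCoord (accuracy n γ) I.α (l + 1) : ℚ) : ℝ) ≤
        accuracy n γ * I.α + (1 + accuracy n γ) * queryCoord (accuracy n γ) I.α l := by
      exact_mod_cast queryCoord_succ_le hε I.α_pos l
    have h2 := hx.1.le
    refine h1.trans ?_
    gcongr

theorem marginal_reducedInstance_le (i : Fin n) :
    (reducedInstance I hn hγ).marginal i ≤
      ENNReal.ofReal ((1 + (accuracy n γ : ℝ)) ^ 2) •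
        (I.μ i).map (reducedInstance I hn hγ).roundUp := by
  have := I.isProb i
  refine DiscreteInstance.marginal_le _ fun j => ?_
  rw [roundIndex_reducedInstance_preimage, ← ofReal_measureReal,
    ← ENNReal.ofReal_mul (by positivity)]
  exact ENNReal.ofReal_le_ofReal (queryProb_le (I.nice i).1 (accuracy_pos hn hγ)
    ((accuracy_le hn hγ).trans_lt (by norm_num)) I.α_pos (Nat.le_of_lt_succ j.2))

theorem map_roundUp_reducedInstance_le (i : Fin n) :
    (I.μ i).map (reducedInstance I hn hγ).roundUp ≤
      ENNReal.ofReal ((1 + (accuracy n γ : ℝ)) ^ 2) • (reducedInstance I hn hγ).marginal i := by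
  have := I.isProb i
  refine DiscreteInstance.map_roundUp_le _ fun j => ?_
  rw [roundIndex_reducedInstance_preimage, ← ofReal_measureReal,
    ← ENNReal.ofReal_mul (by positivity)]
  exact ENNReal.ofReal_le_ofReal (le_queryProb (I.nice i).1 (accuracy_pos hn hγ)
    ((accuracy_le hn hγ).trans_lt (by norm_num)) I.α_pos (Nat.le_of_lt_succ j.2))

theorem IsApproxSolution.of_reducedInstance {B : Finset (Fin n → unitInterval)}
    (hB : IsApproxSolution (reducedInstance I hn hγ).measure (reducedInstance I hn hγ).c
      (reducedInstance I hn hγ).k (1 + (γ : ℝ) / 15) B) :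
    IsApproxSolution I.measure I.c I.k (1 + (γ : ℝ)) B := by
  have := I.isProb
  have hε' : (0 : ℝ) < accuracy n γ := by exact_mod_cast accuracy_pos hn hγ
  have hγ' : (0 : ℝ) < γ := by exact_mod_cast hγ
  set J := reducedInstance I hn hγ with hJ
  have hmap : ∀ i, IsProbabilityMeasure ((I.μ i).map J.roundUp) := fun i =>
    Measure.isProbabilityMeasure_map J.measurable_roundUp.aemeasurable
  have hprob : IsProbabilityMeasure I.measure := by unfold Instance.measure; infer_instance
  set C : ℝ≥0∞ := ENNReal.ofReal ((1 + (accuracy n γ : ℝ)) ^ 2) with hC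
  have hC0 : C ≠ 0 := by rw [hC, Ne, ENNReal.ofReal_eq_zero, not_le]; positivity
  have h1 : J.measure ≤ C ^ n • I.measure.map J.roundVec := by
    have := pi_le_smul_pi hC0 ENNReal.ofReal_ne_top (marginal_reducedInstance_le I hn hγ)
    rwa [Fintype.card_fin, ← J.map_roundVec I.μ] at this
  have h2 : I.measure.map J.roundVec ≤ C ^ n • J.measure := by
    have := pi_le_smul_pi hC0 ENNReal.ofReal_ne_top (map_roundUp_reducedInstance_le I hn hγ)
    rwa [Fintype.card_fin, ← J.map_roundVec I.μ] at this
  refine ⟨hB.1.of_map_le J.measurable_roundVec J.le_roundVec h2, ?_⟩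
  have hpos : ENNReal.ofReal (1 + (γ : ℝ)) ≠ 0 := by
    rw [Ne, ENNReal.ofReal_eq_zero, not_le]; positivity
  -- Dividing by `1 + γ` leaves a lower bound for an infimum, so `B` is compared with every feasible
  -- `B'` and no optimal solution is needed.
  rw [mul_comm, ← ENNReal.div_le_iff_le_mul (Or.inl hpos) (Or.inl ENNReal.ofReal_ne_top)]
  refine le_iInf₂ fun B' hB' => ?_
  rw [ENNReal.div_le_iff_le_mul (Or.inl hpos) (Or.inl ENNReal.ofReal_ne_top), mul_comm]
  obtain ⟨B'', hB'', hcost⟩ := exists_isSolution_of_le_map hn J.measurable_roundVec J.roundVec_mono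
    h1 hB' (r := 1 + (accuracy n γ : ℝ)) (s := accuracy n γ * I.α) (by positivity)
    (mul_nonneg hε'.le (by exact_mod_cast I.α_pos.le)) I.c_nonneg
    fun b i => roundUp_reducedInstance_le I hn hγ (b i)
  have hlow := le_expectedCost I.c_nonneg I.α_le B'
  have hopt : optCost J.measure J.c J.k ≤ expectedCost J.measure J.c B'' := iInf₂_le B'' hB''
  calc expectedCost I.measure I.c B
      ≤ C ^ n * expectedCost J.measure J.c B :=
        expectedCost_le_of_map_le J.measurable_roundVec J.le_roundVec h2
    _ ≤ C ^ n * (ENNReal.ofReal (1 + (γ : ℝ) / 15) * optCost J.measure J.c J.k) := by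
        gcongr
        exact hB.2
    _ ≤ C ^ n * (ENNReal.ofReal (1 + (γ : ℝ) / 15) * (C ^ n *
          (ENNReal.ofReal (accuracy n γ * I.α * ∑ i, (I.c i : ℝ)) +
            ENNReal.ofReal (1 + accuracy n γ) * expectedCost I.measure I.c B'))) := by
        gcongr
        exact hopt.trans hcost
    -- The bound on the means absorbs the additive error into `ε` times the cost of `B'`.
    _ ≤ C ^ n * (ENNReal.ofReal (1 + (γ : ℝ) / 15) * (C ^ n *
          (ENNReal.ofReal (accuracy n γ) * expectedCost I.measure I.c B' +
            ENNReal.ofReal (1 + accuracy n γ) * expectedCost I.measure I.c B'))) := by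
        gcongr
        rw [mul_assoc, ENNReal.ofReal_mul hε'.le]
        gcongr
        exact hlow
    _ = ENNReal.ofReal (((1 + (accuracy n γ : ℝ)) ^ 2) ^ n * (1 + (γ : ℝ) / 15) *
          (((1 + (accuracy n γ : ℝ)) ^ 2) ^ n * (1 + 2 * (accuracy n γ : ℝ)))) *
          expectedCost I.measure I.c B' := by
        rw [← add_mul, ← ENNReal.ofReal_add hε'.le (by positivity), hC,
          ← ENNReal.ofReal_pow (by positivity), ← mul_assoc, ← mul_assoc, ← mul_assoc,
          ← ENNReal.ofReal_mul (by positivity), ← ENNReal.ofReal_mul (by positivity),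
          ← ENNReal.ofReal_mul (by positivity)]
        congr 2
        ring
    _ ≤ ENNReal.ofReal (1 + (γ : ℝ)) * expectedCost I.measure I.c B' := by
        gcongr
        exact approximation_factor_le hn hγ

end Reduced

/-! ## Encoding lengths -/

theorem size_mul_le (a b : ℕ) : Nat.size (a * b) ≤ Nat.size a + Nat.size b := by
  rw [Nat.size_le, pow_add]
  exact Nat.mul_lt_mul'' (Nat.lt_size_self a) (Nat.lt_size_self b)

theorem size_add_le (a b : ℕ) : Nat.size (a + b) ≤ Nat.size a + Nat.size b + 1 := by
  rw [Nat.size_le, pow_succ, pow_add]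
  have ha := Nat.lt_size_self a
  have hb := Nat.lt_size_self b
  have := Nat.one_le_two_pow (n := Nat.size a)
  have := Nat.one_le_two_pow (n := Nat.size b)
  nlinarith

theorem size_le_self (n : ℕ) : Nat.size n ≤ n := Nat.size_le.2 Nat.lt_two_pow_self

theorem size_den_pos (x : ℚ) : 0 < Nat.size x.den := Nat.size_pos.2 x.pos

theorem size_den_lt_ratSize (x : ℚ) : Nat.size x.den < ratSize x := by
  unfold ratSize
  omega

theorem ratSize_natCast (n : ℕ) : ratSize n = Nat.size n + 2 := by
  simp [ratSize, Nat.size_one]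
  omega

theorem ratSize_natCast_le (n : ℕ) : ratSize n ≤ n + 2 := by
  rw [ratSize_natCast]
  have := size_le_self n
  omega

theorem ratSize_natCast_mono {m n : ℕ} (h : m ≤ n) : ratSize m ≤ ratSize n := by
  rw [ratSize_natCast, ratSize_natCast]
  have := Nat.size_le_size h
  omega

theorem ratSize_neg (x : ℚ) : ratSize (-x) = ratSize x := by simp [ratSize]

theorem ratSize_inv (x : ℚ) : ratSize x⁻¹ = ratSize x := by
  by_cases hx : x = 0
  · simp [hx]
  · have hn : x.num ≠ 0 := by simpa using hx
    simp only [ratSize, Rat.num_inv, Rat.den_inv, hn, if_false, Int.natAbs_mul,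
      Int.natAbs_natCast, Int.natAbs_sign_of_ne_zero hn, one_mul]
    omega

theorem ratSize_divInt_le (a : ℤ) {b : ℕ} (hb : b ≠ 0) :
    ratSize (Rat.divInt a b) ≤ 1 + Nat.size a.natAbs + Nat.size b := by
  have hb' : (b : ℤ) ≠ 0 := by exact_mod_cast hb
  have h2 : Nat.size (Rat.divInt a b).den ≤ Nat.size b :=
    Nat.size_le_size (Nat.le_of_dvd (Nat.pos_of_ne_zero hb) (by exact_mod_cast Rat.den_dvd a b))
  have h1 : Nat.size (Rat.divInt a b).num.natAbs ≤ Nat.size a.natAbs := by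
    rcases eq_or_ne a 0 with rfl | ha
    · simp
    · exact Nat.size_le_size (Nat.le_of_dvd (Int.natAbs_pos.2 ha)
        (Int.natAbs_dvd_natAbs.2 (Rat.num_dvd a hb')))
  unfold ratSize
  omega

theorem ratSize_mul_le (x y : ℚ) : ratSize (x * y) ≤ ratSize x + ratSize y := by
  have h : x * y = Rat.divInt (x.num * y.num) ((x.den * y.den : ℕ) : ℤ) := by
    rw [Rat.divInt_eq_div]
    push_cast
    rw [← div_mul_div_comm, Rat.num_div_den, Rat.num_div_den]
  rw [h]
  refine (ratSize_divInt_le _ (mul_ne_zero x.den_nz y.den_nz)).trans ?_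
  have h1 := size_mul_le x.num.natAbs y.num.natAbs
  have h2 := size_mul_le x.den y.den
  rw [← Int.natAbs_mul] at h1
  unfold ratSize
  omega

theorem ratSize_div_le (x y : ℚ) : ratSize (x / y) ≤ ratSize x + ratSize y := by
  rw [div_eq_mul_inv, ← ratSize_inv y]
  exact ratSize_mul_le _ _

/-- Cross-multiplication puts all four parts into the numerator and both denominators into the new
one, whence the factor `2`. Iterated over a long sum this bound would grow exponentially. -/
theorem ratSize_add_le (x y : ℚ) : ratSize (x + y) ≤ 2 * (ratSize x + ratSize y) := by
  rw [Rat.add_num_den]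
  refine (ratSize_divInt_le _ (mul_ne_zero x.den_nz y.den_nz)).trans ?_
  have h1 := size_mul_le x.num.natAbs y.den
  have h2 := size_mul_le x.den y.num.natAbs
  have h3 := size_mul_le x.den y.den
  have h4 := size_add_le (x.num.natAbs * y.den) (x.den * y.num.natAbs)
  have h5 : Nat.size (x.num * y.den + x.den * y.num).natAbs ≤
      Nat.size (x.num.natAbs * y.den + x.den * y.num.natAbs) := by
    refine Nat.size_le_size ((Int.natAbs_add_le _ _).trans_eq ?_)
    simp [Int.natAbs_mul]
  unfold ratSize
  omega

theorem ratSize_sub_le (x y : ℚ) : ratSize (x - y) ≤ 2 * (ratSize x + ratSize y) := by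
  rw [sub_eq_add_neg, ← ratSize_neg y]
  exact ratSize_add_le _ _

theorem natAbs_floor_le (x : ℚ) : ⌊x⌋.natAbs ≤ x.num.natAbs := by
  rw [Rat.floor_def']
  exact Int.natAbs_ediv_le_natAbs _ _

theorem ratSize_floor_le (x : ℚ) : ratSize (⌊x⌋ : ℚ) ≤ ratSize x := by
  have h1 := Nat.size_le_size (natAbs_floor_le x)
  have h2 := size_den_pos x
  simp only [ratSize, Rat.num_intCast, Rat.den_intCast, Nat.size_one]
  omega

theorem ratSize_pow_le (x : ℚ) (m : ℕ) : ratSize (x ^ m) ≤ m * ratSize x + 3 := by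
  induction m with
  | zero => simp [ratSize, Nat.size_one]
  | succ m ih =>
    rw [pow_succ, Nat.succ_mul]
    exact (ratSize_mul_le _ _).trans (by omega)

/-- A number in `[0, 2]` is encoded by about twice as many digits as its denominator. -/
theorem ratSize_le_of_le_two {x : ℚ} (h0 : 0 ≤ x) (h2 : x ≤ 2) :
    ratSize x ≤ 2 * Nat.size x.den + 4 := by
  have h : x.num.natAbs ≤ 2 * x.den := by
    have h3 : (x.num : ℚ) ≤ 2 * x.den := by
      rw [← div_le_iff₀ (by exact_mod_cast x.pos), Rat.num_div_den]
      exact h2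
    have h4 : x.num ≤ 2 * x.den := by exact_mod_cast h3
    have h5 := Rat.num_nonneg.2 h0
    omega
  have h6 := (Nat.size_le_size h).trans (size_mul_le 2 x.den)
  have h7 : Nat.size 2 ≤ 2 := size_le_self 2
  unfold ratSize
  omega

/-- The denominator of a sum divides the product of the denominators, so lengths add up instead of
doubling. For sums in `[0, 2]`, `ratSize_le_of_le_two` then controls the numerator. -/
theorem size_den_sum_le {ι : Type*} (s : Finset ι) (f : ι → ℚ) {b : ℕ}
    (h : ∀ i ∈ s, ratSize (f i) ≤ b) : Nat.size (∑ i ∈ s, f i).den ≤ s.card * b + 1 := by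
  classical
  induction s using Finset.induction_on with
  | empty => simp [Nat.size_one]
  | insert i s hi ih =>
    rw [Finset.sum_insert hi, Finset.card_insert_of_notMem hi, Nat.succ_mul]
    have h1 := ih fun j hj => h j (Finset.mem_insert_of_mem hj)
    have h2 := h i (Finset.mem_insert_self i s)
    have h3 := size_den_lt_ratSize (f i)
    have h4 := (Nat.size_le_size (Nat.le_of_dvd (Nat.mul_pos (f i).pos (∑ i ∈ s, f i).pos)
      (Rat.add_den_dvd (f i) (∑ i ∈ s, f i)))).trans (size_mul_le _ _)
    omega

/-! ## Cost bounds for expressions and programs -/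

/-- All memory entries have encoding length at most `b`. -/
def Store.Bounded (s : Store) (b : ℕ) : Prop := ∀ A l, ratSize (s A l) ≤ b

theorem Store.set_apply (s : Store) (A l : ℕ) (q : ℚ) (A' l' : ℕ) :
    s.set A l q A' l' = if A' = A ∧ l' = l then q else s A' l' := by
  unfold Store.set
  rcases eq_or_ne A' A with rfl | hA
  · rcases eq_or_ne l' l with rfl | hl <;> simp [*]
  · simp [hA]

theorem Store.Bounded.set {s : Store} {b : ℕ} (hs : s.Bounded b) (A l : ℕ) {q : ℚ}
    (hq : ratSize q ≤ b) : (s.set A l q).Bounded b := by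
  intro A' l'
  rw [Store.set_apply]
  split_ifs
  exacts [hq, hs A' l']

namespace Expr

/-- The encoding length of the value, in multiples of a bound for the literals and the memory. -/
def valWeight : Expr → ℕ
  | .lit _ => 1
  | .read _ _ => 1
  | .add x y => 2 * (x.valWeight + y.valWeight)
  | .sub x y => 2 * (x.valWeight + y.valWeight)
  | .mul x y => x.valWeight + y.valWeight
  | .div x y => x.valWeight + y.valWeight
  | .floor x => x.valWeight

/-- The bit cost, in multiples of a bound for the literals and the memory. -/
def costWeight : Expr → ℕ
  | .lit _ => 1
  | .read _ e => e.costWeight + 1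
  | .add x y => x.costWeight + y.costWeight + 2 * (x.valWeight + y.valWeight)
  | .sub x y => x.costWeight + y.costWeight + 2 * (x.valWeight + y.valWeight)
  | .mul x y => x.costWeight + y.costWeight + (x.valWeight + y.valWeight)
  | .div x y => x.costWeight + y.costWeight + (x.valWeight + y.valWeight)
  | .floor x => x.costWeight + x.valWeight

/-- All literals have encoding length at most `b`. -/
def LitBounded (b : ℕ) : Expr → Prop
  | .lit q => ratSize q ≤ b
  | .read _ e => e.LitBounded b
  | .add x y => x.LitBounded b ∧ y.LitBounded b
  | .sub x y => x.LitBounded b ∧ y.LitBounded b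
  | .mul x y => x.LitBounded b ∧ y.LitBounded b
  | .div x y => x.LitBounded b ∧ y.LitBounded b
  | .floor x => x.LitBounded b

/-- The factor depends on the expression alone: each operation at most doubles the total length of
its arguments, and a `read` starts again at `b`, whatever its position. -/
theorem ratSize_val_le {s : Store} {b : ℕ} (hs : s.Bounded b) (e : Expr)
    (he : e.LitBounded b) : ratSize (e.val s) ≤ e.valWeight * b := by
  induction e with
  | lit q => simpa [valWeight, val, LitBounded] using he
  | read A e _ => simpa [valWeight, val] using hs A _
  | add x y hx hy =>
    have := ratSize_add_le (x.val s) (y.val s)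
    have := hx he.1
    have := hy he.2
    simp only [valWeight, val, mul_assoc, add_mul]
    omega
  | sub x y hx hy =>
    have := ratSize_sub_le (x.val s) (y.val s)
    have := hx he.1
    have := hy he.2
    simp only [valWeight, val, mul_assoc, add_mul]
    omega
  | mul x y hx hy =>
    have := ratSize_mul_le (x.val s) (y.val s)
    have := hx he.1
    have := hy he.2
    simp only [valWeight, val, add_mul]
    omega
  | div x y hx hy =>
    have := ratSize_div_le (x.val s) (y.val s)
    have := hx he.1
    have := hy he.2
    simp only [valWeight, val, add_mul]
    omega
  | floor x hx => exact (ratSize_floor_le _).trans (hx he)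

theorem cost_le {s : Store} {b : ℕ} (hs : s.Bounded b) (e : Expr) (he : e.LitBounded b) :
    e.cost s ≤ e.costWeight * b := by
  induction e with
  | lit q => simpa [costWeight, cost, LitBounded] using he
  | read A e ih =>
    have := hs A ⌊e.val s⌋₊
    have := ih he
    simp only [costWeight, cost, add_mul, one_mul]
    omega
  | add x y hx hy =>
    have := ratSize_val_le hs (add x y) he
    have := hx he.1
    have := hy he.2
    simp only [costWeight, cost, valWeight, val, add_mul, mul_assoc] at *
    omega
  | sub x y hx hy =>
    have := ratSize_val_le hs (sub x y) he
    have := hx he.1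
    have := hy he.2
    simp only [costWeight, cost, valWeight, val, add_mul, mul_assoc] at *
    omega
  | mul x y hx hy =>
    have := ratSize_val_le hs (mul x y) he
    have := hx he.1
    have := hy he.2
    simp only [costWeight, cost, valWeight, val, add_mul] at *
    omega
  | div x y hx hy =>
    have := ratSize_val_le hs (div x y) he
    have := hx he.1
    have := hy he.2
    simp only [costWeight, cost, valWeight, val, add_mul] at *
    omega
  | floor x hx =>
    have := ratSize_val_le hs (floor x) he
    have := hx he
    simp only [costWeight, cost, valWeight, val, add_mul] at *
    omega

end Expr

namespace Program

/-- The cost of executing every instruction once, in multiples of a bound for the literals, the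
memory and the time of the oracles. -/
def weight : Program → ℕ
  | .skip => 1
  | .write _ e x => 1 + e.costWeight + x.costWeight
  | .query _ e i a b δ =>
    2 + e.costWeight + i.costWeight + a.costWeight + b.costWeight + δ.costWeight
  | .seq P Q => 1 + P.weight + Q.weight
  | .ite e P Q => 1 + e.costWeight + P.weight + Q.weight
  | .loop e P => 1 + e.costWeight + P.weight

end Program

/-- Started on `s`, the program `P` halts with a memory satisfying `Q`, at cost at most
`P.weight * b * N`. -/
def Runs {n : ℕ} (σ : Fin n → Oracle) (b N : ℕ) (P : Program) (s : Store)
    (Q : Store → Prop) : Prop :=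
  ∃ s' t, Exec σ P s s' t ∧ Q s' ∧ t ≤ P.weight * b * N

section Runs

variable {n : ℕ} {σ : Fin n → Oracle} {b N : ℕ} {s : Store} {Q : Store → Prop}

theorem Runs.mono {N' : ℕ} {P : Program} {Q' : Store → Prop} (h : Runs σ b N P s Q)
    (hN : N ≤ N') (hQ : ∀ s', Q s' → Q' s') : Runs σ b N' P s Q' := by
  obtain ⟨s', t, he, hq, ht⟩ := h
  exact ⟨s', t, he, hQ _ hq, ht.trans (Nat.mul_le_mul_left _ hN)⟩

theorem Runs.write {A l : ℕ} {e x : Expr} {q : ℚ} (hs : s.Bounded b) (hb : 1 ≤ b) (hN : 1 ≤ N)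
    (hl : e.val s = l) (hq : x.val s = q) (he : e.LitBounded b) (hx : x.LitBounded b)
    (h : Q (s.set A l q)) : Runs σ b N (.write A e x) s Q := by
  refine ⟨_, _, Exec.write s A e x, ?_, ?_⟩
  · rwa [hl, Nat.floor_natCast, hq]
  · have h1 := e.cost_le hs he
    have h2 := x.cost_le hs hx
    refine le_trans ?_ (Nat.le_mul_of_pos_right _ hN)
    simp only [Program.weight, add_mul, one_mul]
    omega

theorem Runs.query {A l : ℕ} {e i x y δ : Expr} {m : Fin n} (hs : s.Bounded b) (hb : 1 ≤ b)
    (hN : 1 ≤ N) (hl : e.val s = l) (hm : i.val s = ((m : ℕ) : ℚ))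
    (hv : ValidQuery (x.val s) (y.val s) (δ.val s))
    (ht : (σ m).time (x.val s) (y.val s) (δ.val s) ≤ b)
    (he : e.LitBounded b) (hi : i.LitBounded b) (hx : x.LitBounded b) (hy : y.LitBounded b)
    (hδ : δ.LitBounded b)
    (h : Q (s.set A l ((σ m).ans (x.val s) (y.val s) (δ.val s)))) :
    Runs σ b N (.query A e i x y δ) s Q := by
  refine ⟨_, _, Exec.query s A e i x y δ m hm hv, ?_, ?_⟩
  · rwa [hl, Nat.floor_natCast]
  · have h1 := e.cost_le hs he
    have h2 := i.cost_le hs hi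
    have h3 := x.cost_le hs hx
    have h4 := y.cost_le hs hy
    have h5 := δ.cost_le hs hδ
    refine le_trans ?_ (Nat.le_mul_of_pos_right _ hN)
    simp only [Program.weight, add_mul]
    omega

theorem Runs.seq {P₁ P₂ : Program} {R : Store → Prop} (hb : 1 ≤ b) (hN : 1 ≤ N)
    (h₁ : Runs σ b N P₁ s R) (h₂ : ∀ s', R s' → Runs σ b N P₂ s' Q) :
    Runs σ b N (.seq P₁ P₂) s Q := by
  obtain ⟨s₁, t₁, he₁, hR, ht₁⟩ := h₁
  obtain ⟨s₂, t₂, he₂, hQ, ht₂⟩ := h₂ s₁ hR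
  refine ⟨s₂, _, he₁.seq he₂, hQ, ?_⟩
  have := Nat.mul_pos hb hN
  simp only [Program.weight, add_mul, one_mul]
  omega

theorem Runs.ite {e : Expr} {P₁ P₂ : Program} (hs : s.Bounded b) (hb : 1 ≤ b) (hN : 1 ≤ N)
    (he : e.LitBounded b) (h₁ : 0 < e.val s → Runs σ b N P₁ s Q)
    (h₂ : e.val s ≤ 0 → Runs σ b N P₂ s Q) : Runs σ b N (.ite e P₁ P₂) s Q := by
  have hc := (e.cost_le hs he).trans (Nat.le_mul_of_pos_right _ hN)
  have := Nat.mul_pos hb hN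
  rcases lt_or_ge 0 (e.val s) with h | h
  · obtain ⟨s', t, hx, hQ, ht⟩ := h₁ h
    refine ⟨s', _, hx.ite_true h, hQ, ?_⟩
    simp only [Program.weight, add_mul, one_mul]
    omega
  · obtain ⟨s', t, hx, hQ, ht⟩ := h₂ h
    refine ⟨s', _, hx.ite_false h, hQ, ?_⟩
    simp only [Program.weight, add_mul, one_mul]
    omega

/-- A loop with invariant `Inv`, indexed by the number of iterations, that ends after `L`
iterations. -/
theorem Runs.loop {e : Expr} {P : Program} {L N' : ℕ} {Inv : ℕ → Store → Prop} (hb : 1 ≤ b)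
    (hN' : 1 ≤ N') (hN : (L + 1) * N' ≤ N) (he : e.LitBounded b)
    (hbd : ∀ m s, Inv m s → s.Bounded b)
    (hstep : ∀ m < L, ∀ s, Inv m s → 0 < e.val s ∧ Runs σ b N' P s (Inv (m + 1)))
    (hend : ∀ s, Inv L s → e.val s ≤ 0 ∧ Q s) (h0 : Inv 0 s) :
    Runs σ b N (.loop e P) s Q := by
  -- Induction on the number `d` of iterations left; `d + 1` also counts the final failing test.
  have key : ∀ d m, m + d = L → ∀ s, Inv m s → ∃ s' t, Exec σ (.loop e P) s s' t ∧ Q s' ∧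
      t ≤ (Program.loop e P).weight * b * ((d + 1) * N') := by
    intro d
    induction d with
    | zero =>
      intro m hm s hs
      obtain rfl : m = L := by omega
      refine ⟨s, _, Exec.loop_false (hend s hs).1, (hend s hs).2, ?_⟩
      have h1 := (e.cost_le (hbd _ _ hs) he).trans (Nat.le_mul_of_pos_right _ hN')
      have := Nat.mul_pos hb hN'
      rw [zero_add, one_mul]
      simp only [Program.weight, add_mul, one_mul]
      omega
    | succ d ih =>
      intro m hm s hs
      obtain ⟨hpos, s₁, t₁, hx₁, hI, ht₁⟩ := hstep m (by omega) s hs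
      obtain ⟨s₂, t₂, hx₂, hQ, ht₂⟩ := ih (m + 1) (by omega) s₁ hI
      refine ⟨s₂, _, Exec.loop_true hpos hx₁ hx₂, hQ, ?_⟩
      have h1 := (e.cost_le (hbd _ _ hs) he).trans (Nat.le_mul_of_pos_right _ hN')
      have := Nat.mul_pos hb hN'
      rw [Nat.succ_mul (d + 1) N', mul_add]
      have h2 : 1 + e.cost s + t₁ ≤ (Program.loop e P).weight * b * N' := by
        simp only [Program.weight, add_mul, one_mul]
        omega
      omega
  obtain ⟨s', t, hx, hQ, ht⟩ := key L 0 (zero_add L) s h0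
  exact ⟨s', t, hx, hQ, ht.trans (Nat.mul_le_mul_left _ hN)⟩

end Runs

/-! ## The program -/

namespace Reduction

/-- The dimension. -/
abbrev dim : Expr := .read 0 (.lit 0)
/-- The number of points of a cover. -/
abbrev coverSize : Expr := .read 0 (.lit 1)
/-- The lower bound for the means. -/
abbrev meanBound : Expr := .read 0 (.lit 2)
/-- The parameter `γ`. -/
abbrev param : Expr := .read 0 (.lit 3)
/-- The number of grid points found so far. -/
abbrev count : Expr := .read 2 (.lit 2)
/-- The accuracy `ε`. -/
abbrev eps : Expr := .read 6 (.lit 0)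
/-- The next power `ε α (1 + ε)^m`. -/
abbrev power : Expr := .read 6 (.lit 1)
/-- The current coordinate. -/
abbrev row : Expr := .read 6 (.lit 2)
/-- The current grid point. -/
abbrev col : Expr := .read 6 (.lit 3)
/-- The sum of the oracle answers. -/
abbrev total : Expr := .read 6 (.lit 4)
/-- The preceding grid point. -/
abbrev prev : Expr := .read 6 (.lit 5)
/-- The number of grid points that remain in a row. -/
abbrev remaining : Expr := .sub (.add count (.lit 2)) col

/-- Computes the accuracy. -/
def setEps : Program :=
  .ite (.sub param (.lit 1))
    (.write 6 (.lit 0) (.div (.lit 1) (.mul (.lit 60) dim)))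
    (.write 6 (.lit 0) (.div param (.mul (.lit 60) dim)))

/-- Stores one more grid point. -/
def gridStep : Program :=
  .seq (.write 2 (.lit 2) (.add count (.lit 1)))
    (.seq (.write 3 count power)
      (.write 6 (.lit 1) (.mul power (.add (.lit 1) eps))))

/-- Computes the grid. -/
def grid : Program :=
  .seq setEps
    (.seq (.write 2 (.lit 0) dim)
      (.seq (.write 2 (.lit 1) coverSize)
        (.seq (.write 6 (.lit 1) (.mul eps meanBound))
          (.seq (.loop (.sub (.lit 1) power) gridStep)
            (.write 3 (.add count (.lit 1)) (.lit 1))))))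

/-- Queries the mass of one cell. -/
def queryStep : Program :=
  .seq (.query 7 col row prev (.read 3 col) eps)
    (.seq (.write 6 (.lit 4) (.add total (.read 7 col)))
      (.seq (.write 6 (.lit 5) (.read 3 col))
        (.write 6 (.lit 3) (.add col (.lit 1)))))

/-- Normalizes one oracle answer. -/
def normalizeStep : Program :=
  .seq (.write 4 (.add (.mul row (.add count (.lit 2))) col) (.div (.read 7 col) total))
    (.write 6 (.lit 3) (.add col (.lit 1)))

/-- Computes the distribution of one coordinate. -/
def rowStep : Program :=
  .seq (.write 6 (.lit 3) (.lit 0))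
    (.seq (.write 6 (.lit 4) (.lit 0))
      (.seq (.write 6 (.lit 5) (.lit (-1)))
        (.seq (.loop remaining queryStep)
          (.seq (.write 6 (.lit 3) (.lit 0))
            (.seq (.loop remaining normalizeStep)
              (.seq (.write 5 row (.read 1 row))
                (.write 6 (.lit 2) (.add row (.lit 1)))))))))

/-- Computes the reduced instance. -/
def program : Program := .seq grid (.loop (.sub dim row) rowStep)

end Reduction

/-! ## Correctness of the program -/

/-- All numbers that occur in the reduction have encoding length at most `b`, and the oracles
answer in time `b`. -/
structure SizeBound {n : ℕ} (I : Instance n) (γ : ℚ) (b : ℕ) : Prop where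
  lit : 62 ≤ b
  param : ratSize γ ≤ b
  coverSize : ratSize I.k ≤ b
  meanBound : ratSize I.α ≤ b
  cost : ∀ i, ratSize (I.c i) ≤ b
  dim : ratSize n ≤ b
  count : ratSize (queryCount (accuracy n γ) I.α + 2 : ℕ) ≤ b
  eps : ratSize (accuracy n γ) ≤ b
  pow : ∀ m ≤ queryCount (accuracy n γ) I.α,
    ratSize (accuracy n γ * I.α * (1 + accuracy n γ) ^ m) ≤ b
  weight : ∀ i, ∀ l ≤ queryCount (accuracy n γ) I.α + 1,
    ratSize (queryWeight (I.oracle i) (accuracy n γ) I.α l) ≤ b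
  sum : ∀ i, ∀ m ≤ queryCount (accuracy n γ) I.α + 2,
    ratSize (∑ l ∈ Finset.range m, queryWeight (I.oracle i) (accuracy n γ) I.α l) ≤ b
  prob : ∀ i, ∀ l ≤ queryCount (accuracy n γ) I.α + 1,
    ratSize (queryProb (I.oracle i) (accuracy n γ) I.α l) ≤ b
  time : ∀ i, ∀ l ≤ queryCount (accuracy n γ) I.α + 1,
    (I.oracle i).time (queryPrev (accuracy n γ) I.α l) (queryCoord (accuracy n γ) I.α l)
      (accuracy n γ) ≤ b

/-- The largest literal of the program is `60`, and `62 = 60 + 2` is its bound from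
`ratSize_natCast_le`. -/
theorem ratSize_lit_le {b : ℕ} (hb : 62 ≤ b) :
    ratSize 0 ≤ b ∧ ratSize 1 ≤ b ∧ ratSize 2 ≤ b ∧ ratSize 3 ≤ b ∧ ratSize 4 ≤ b ∧
      ratSize 5 ≤ b ∧ ratSize 60 ≤ b ∧ ratSize (-1) ≤ b := by
  have h : ∀ m : ℕ, m ≤ 60 → ratSize m ≤ b := fun m hm => (ratSize_natCast_le m).trans (by omega)
  rw [ratSize_neg]
  have h0 := h 0 (by omega)
  have h1 := h 1 (by omega)
  push_cast at h0 h1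
  exact ⟨h0, h1, h 2 (by omega), h 3 (by omega), h 4 (by omega), h 5 (by omega), h 60 le_rfl, h1⟩

section Correctness

variable {n : ℕ} {I : Instance n} {γ : ℚ} {b : ℕ}

theorem SizeBound.natCast_dim (hb : SizeBound I γ b) {m : ℕ} (hm : m ≤ n) : ratSize m ≤ b :=
  (ratSize_natCast_mono hm).trans hb.dim

theorem SizeBound.natCast_count (hb : SizeBound I γ b) {m : ℕ}
    (hm : m ≤ queryCount (accuracy n γ) I.α + 2) : ratSize m ≤ b :=
  (ratSize_natCast_mono hm).trans hb.count

theorem SizeBound.coord (hb : SizeBound I γ b) (l : ℕ) :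
    ratSize (queryCoord (accuracy n γ) I.α l) ≤ b := by
  obtain ⟨h0, h1, -⟩ := ratSize_lit_le hb.lit
  unfold queryCoord
  split_ifs with h h'
  exacts [h0, hb.pow _ (by omega), h1]

/-- The input, the accuracy and the copied part of the output are in place. -/
structure BaseInv (I : Instance n) (γ : ℚ) (b : ℕ) (s : Store) : Prop where
  bounded : s.Bounded b
  dim : s 0 0 = n
  meanBound : s 0 2 = I.α
  cost : ∀ i : Fin n, s 1 i = I.c i
  eps : s 6 0 = accuracy n γ
  outDim : s 2 0 = n
  outCoverSize : s 2 1 = I.k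

/-- A frame rule: the side conditions exclude exactly the arrays and positions whose contents the
invariant fixes. -/
theorem BaseInv.set {s : Store} (h : BaseInv I γ b s) {A l : ℕ} {q : ℚ} (hA : 2 ≤ A)
    (h2 : A = 2 → 2 ≤ l) (h6 : A = 6 → l ≠ 0) (hq : ratSize q ≤ b) :
    BaseInv I γ b (s.set A l q) := by
  refine ⟨h.bounded.set A l hq, ?_, ?_, fun i => ?_, ?_, ?_, ?_⟩ <;>
    rw [Store.set_apply, if_neg (by omega)]
  exacts [h.dim, h.meanBound, h.cost i, h.eps, h.outDim, h.outCoverSize]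

/-- The invariant of the loop that computes the grid. -/
structure GridLoopInv (I : Instance n) (γ : ℚ) (b m : ℕ) (s : Store) : Prop
    extends BaseInv I γ b s where
  count : s 2 2 = m
  power : s 6 1 = accuracy n γ * I.α * (1 + accuracy n γ) ^ m
  coord : ∀ l ≤ m, s 3 l = queryCoord (accuracy n γ) I.α l
  row : s 6 2 = 0

/-- The grid is in place. -/
structure GridInv (I : Instance n) (γ : ℚ) (b : ℕ) (s : Store) : Prop
    extends BaseInv I γ b s where
  count : s 2 2 = queryCount (accuracy n γ) I.α
  coord : ∀ l ≤ queryCount (accuracy n γ) I.α + 1, s 3 l = queryCoord (accuracy n γ) I.α l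

theorem GridInv.set {s : Store} (h : GridInv I γ b s) {A l : ℕ} {q : ℚ} (hA : 4 ≤ A)
    (h6 : A = 6 → l ≠ 0) (hq : ratSize q ≤ b) : GridInv I γ b (s.set A l q) := by
  refine ⟨h.toBaseInv.set (by omega) (by omega) h6 hq, ?_, fun m hm => ?_⟩ <;>
    rw [Store.set_apply, if_neg (by omega)]
  exacts [h.count, h.coord m hm]

/-- The grid and the output for the first `r` coordinates are in place. -/
structure RowInv (I : Instance n) (γ : ℚ) (b r : ℕ) (s : Store) : Prop
    extends GridInv I γ b s where
  row : s 6 2 = r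
  prob : ∀ i : Fin n, (i : ℕ) < r → ∀ l < queryCount (accuracy n γ) I.α + 2,
    s 4 (i * (queryCount (accuracy n γ) I.α + 2) + l) =
      queryProb (I.oracle i) (accuracy n γ) I.α l
  outCost : ∀ i : Fin n, (i : ℕ) < r → s 5 i = I.c i

theorem RowInv.set {s : Store} {r : ℕ} (h : RowInv I γ b r s) {A l : ℕ} {q : ℚ} (hA : 4 ≤ A)
    (h4 : A = 4 → r * (queryCount (accuracy n γ) I.α + 2) ≤ l) (h5 : A = 5 → r ≤ l)
    (h6 : A = 6 → 3 ≤ l) (hq : ratSize q ≤ b) : RowInv I γ b r (s.set A l q) := by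
  refine ⟨h.toGridInv.set hA (by omega) hq, ?_, fun i hi m hm => ?_, fun i hi => ?_⟩
  · rw [Store.set_apply, if_neg (by omega), h.row]
  · rw [Store.set_apply, if_neg, h.prob i hi m hm]
    rintro ⟨rfl, rfl⟩
    have h1 := h4 rfl
    -- Row `i` ends before position `(i + 1)(M + 2) ≤ r (M + 2)`, where the writes begin.
    have h2 := Nat.mul_le_mul_right (queryCount (accuracy n γ) I.α + 2) (Nat.succ_le_of_lt hi)
    rw [Nat.succ_mul] at h2
    omega
  · rw [Store.set_apply, if_neg (by omega), h.outCost i hi]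

/-- The invariant of the loop that queries the oracle of coordinate `i`. -/
structure QueryInv (I : Instance n) (γ : ℚ) (b : ℕ) (i : Fin n) (m : ℕ) (s : Store) : Prop
    extends RowInv I γ b i s where
  col : s 6 3 = m
  total : s 6 4 = ∑ l ∈ Finset.range m, queryWeight (I.oracle i) (accuracy n γ) I.α l
  prev : s 6 5 = queryPrev (accuracy n γ) I.α m
  answer : ∀ l < m, s 7 l = queryWeight (I.oracle i) (accuracy n γ) I.α l

/-- The invariant of the loop that normalizes the answers of the oracle of coordinate `i`. -/
structure NormalizeInv (I : Instance n) (γ : ℚ) (b : ℕ) (i : Fin n) (m : ℕ) (s : Store) : Prop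
    extends RowInv I γ b i s where
  col : s 6 3 = m
  total : s 6 4 = ∑ l ∈ Finset.range (queryCount (accuracy n γ) I.α + 2),
    queryWeight (I.oracle i) (accuracy n γ) I.α l
  answer : ∀ l < queryCount (accuracy n γ) I.α + 2,
    s 7 l = queryWeight (I.oracle i) (accuracy n γ) I.α l
  current : ∀ l < m, s 4 (i * (queryCount (accuracy n γ) I.α + 2) + l) =
    queryProb (I.oracle i) (accuracy n γ) I.α l

theorem bounded_inputStore (hb : SizeBound I γ b) : (inputStore I γ).Bounded b := by
  obtain ⟨h0, -⟩ := ratSize_lit_le hb.lit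
  intro A l
  unfold inputStore
  split
  · exact hb.dim
  · exact hb.coverSize
  · exact hb.meanBound
  · exact hb.param
  · split_ifs
    exacts [hb.cost _, h0]
  · exact h0

theorem runs_write_seq {σ : Fin n → Oracle} {N : ℕ} {P : Program} {s : Store}
    {Q : Store → Prop} {A l : ℕ} {e x : Expr} {q : ℚ} (hs : s.Bounded b) (hb : 1 ≤ b)
    (hN : 1 ≤ N) (hl : e.val s = l) (hq : x.val s = q) (he : e.LitBounded b)
    (hx : x.LitBounded b) (h : Runs σ b N P (s.set A l q) Q) :
    Runs σ b N (.seq (.write A e x) P) s Q :=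
  Runs.seq (R := fun s' => s' = s.set A l q) hb hN (Runs.write hs hb hN hl hq he hx rfl)
    fun _ hs' => hs' ▸ h

theorem runs_setEps (hb : SizeBound I γ b) {s : Store} (hs : s.Bounded b)
    (hdim : s 0 0 = n) (hparam : s 0 3 = γ) :
    Runs I.oracle b 1 Reduction.setEps s (fun s' => s' = s.set 6 0 (accuracy n γ)) := by
  have hb1 : 1 ≤ b := le_trans (by norm_num) hb.lit
  have hl := ratSize_lit_le hb.lit
  refine Runs.ite hs hb1 le_rfl (by simp [Expr.LitBounded, hl]) (fun h => ?_) fun h => ?_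
  · have h1 : 1 < γ := by simpa [Expr.val, hparam] using h
    refine Runs.write (l := 0) hs hb1 le_rfl (by simp [Expr.val])
      ?_ (by simp [Expr.LitBounded, hl]) (by simp [Expr.LitBounded, hl]) rfl
    simp [Expr.val, hdim, accuracy, min_eq_right h1.le]
  · have h1 : γ ≤ 1 := by simpa [Expr.val, hparam] using h
    refine Runs.write (l := 0) hs hb1 le_rfl (by simp [Expr.val])
      ?_ (by simp [Expr.LitBounded, hl]) (by simp [Expr.LitBounded, hl]) rfl
    simp [Expr.val, hdim, hparam, accuracy, min_eq_left h1]

theorem runs_gridStep (hb : SizeBound I γ b) {m : ℕ} (hm : m < queryCount (accuracy n γ) I.α)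
    {s : Store} (h : GridLoopInv I γ b m s) :
    Runs I.oracle b 1 Reduction.gridStep s (GridLoopInv I γ b (m + 1)) := by
  have hb1 : 1 ≤ b := le_trans (by norm_num) hb.lit
  have hl := ratSize_lit_le hb.lit
  have hpow := hb.pow (m + 1) hm
  have hb' := h.toBaseInv.set (A := 2) (l := 2) (q := ((m + 1 : ℕ) : ℚ)) (by omega) (by omega)
    (by omega) (hb.natCast_count (by omega))
  have hb'' := hb'.set (A := 3) (l := m + 1) (q := s 6 1) (by omega) (by omega)
    (by omega) (h.bounded _ _)
  refine runs_write_seq (l := 2) (q := ((m + 1 : ℕ) : ℚ)) h.bounded hb1 le_rfl (by simp [Expr.val])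
    (by simp [Expr.val, h.count]) (by simp [Expr.LitBounded, hl]) (by simp [Expr.LitBounded, hl]) ?_
  -- The count is already incremented, so `ε α (1 + ε)^m` lands at position `m + 1`, as `q_{m+1}`
  -- requires.
  refine runs_write_seq (l := m + 1) (q := s 6 1) hb'.bounded hb1 le_rfl
    (by simp [Expr.val, Store.set_apply])
    (by simp [Expr.val, Store.set_apply])
    (by simp [Expr.LitBounded, hl]) (by simp [Expr.LitBounded, hl]) ?_
  refine Runs.write (l := 1) hb''.bounded hb1 le_rfl (by simp [Expr.val])
    (q := accuracy n γ * I.α * (1 + accuracy n γ) ^ (m + 1))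
    (by simp [Expr.val, Store.set_apply, h.power, h.eps, pow_succ, mul_assoc])
    (by simp [Expr.LitBounded, hl]) (by simp [Expr.LitBounded, hl]) ?_
  refine ⟨hb''.set (by omega) (by omega) (by omega) hpow, ?_, ?_, fun l hlm => ?_, ?_⟩
  · simp [Store.set_apply]
  · simp [Store.set_apply]
  · rcases hlm.lt_or_eq with h1 | rfl
    · simpa [Store.set_apply, h1.ne] using h.coord l (by omega)
    · rw [queryCoord_succ_of_lt hm]
      simp [Store.set_apply, h.power]
  · simp [Store.set_apply, h.row]

theorem runs_grid (hn : 1 ≤ n) (hγ : 0 < γ) (hb : SizeBound I γ b) :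
    Runs I.oracle b (queryCount (accuracy n γ) I.α + 1) Reduction.grid (inputStore I γ)
      (RowInv I γ b 0) := by
  have hb1 : 1 ≤ b := le_trans (by norm_num) hb.lit
  have hl := ratSize_lit_le hb.lit
  have hN : 1 ≤ queryCount (accuracy n γ) I.α + 1 := by omega
  have hε := accuracy_pos hn hγ
  have hs0 := bounded_inputStore hb
  refine Runs.seq hb1 hN ((runs_setEps hb hs0 rfl rfl).mono hN fun _ h => h) ?_
  rintro _ rfl
  have hs1 := hs0.set 6 0 hb.eps
  have hs2 := hs1.set 2 0 hb.dim
  have hs3 := hs2.set 2 1 hb.coverSize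
  refine runs_write_seq (l := 0) (q := n) hs1 hb1 hN (by simp [Expr.val])
    (by simp [Expr.val, Store.set_apply, inputStore])
    (by simp [Expr.LitBounded, hl]) (by simp [Expr.LitBounded, hl]) ?_
  refine runs_write_seq (l := 1) (q := I.k) hs2 hb1 hN (by simp [Expr.val])
    (by simp [Expr.val, Store.set_apply, inputStore])
    (by simp [Expr.LitBounded, hl]) (by simp [Expr.LitBounded, hl]) ?_
  refine runs_write_seq (l := 1) (q := accuracy n γ * I.α * (1 + accuracy n γ) ^ 0) hs3 hb1 hN
    (by simp [Expr.val])
    (by simp [Expr.val, Store.set_apply, inputStore])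
    (by simp [Expr.LitBounded, hl]) (by simp [Expr.LitBounded, hl]) ?_
  refine Runs.seq (R := GridLoopInv I γ b (queryCount (accuracy n γ) I.α)) hb1 hN ?_ ?_
  · refine Runs.loop (Inv := GridLoopInv I γ b) (L := queryCount (accuracy n γ) I.α) hb1 le_rfl
      (by omega) (by simp [Expr.LitBounded, hl]) (fun m s h => h.bounded) (fun m hm s h => ?_)
      (fun s h => ?_) ?_
    · refine ⟨?_, runs_gridStep hb hm h⟩
      -- The loop test is positive exactly while `m < M`; this replaces the logarithm.
      have := (not_congr (queryCount_le_iff hε I.α_pos m)).1 (by omega)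
      simpa [Expr.val, h.power] using this
    · refine ⟨?_, h⟩
      have := (queryCount_le_iff hε I.α_pos _).1 le_rfl
      simpa [Expr.val, h.power] using this
    · refine ⟨⟨hs3.set 6 1 (hb.pow 0 (by omega)), ?_, ?_, ?_, ?_, ?_, ?_⟩, ?_, ?_, ?_, ?_⟩
      · simp [Store.set_apply, inputStore]
      · simp [Store.set_apply, inputStore]
      · intro i
        simp [Store.set_apply, inputStore]
      · simp [Store.set_apply]
      · simp [Store.set_apply]
      · simp [Store.set_apply]
      · simp [Store.set_apply, inputStore]
      · simp [Store.set_apply]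
      -- `q_0 = 0` is the default content of the memory and is never written; the initial count and
      -- row index are defaults too.
      · intro l hl0
        obtain rfl : l = 0 := by omega
        simp [Store.set_apply, inputStore, queryCoord_zero]
      · simp [Store.set_apply, inputStore]
  · intro s h
    refine Runs.write (l := queryCount (accuracy n γ) I.α + 1) (q := 1) h.bounded hb1 hN
      (by simp [Expr.val, h.count]) (by simp [Expr.val])
      (by simp [Expr.LitBounded, hl]) (by simp [Expr.LitBounded, hl]) ?_
    refine ⟨⟨h.toBaseInv.set (by omega) (by omega) (by omega) hl.2.1, ?_, fun l hlm => ?_⟩, ?_,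
      fun i hi => absurd hi (Nat.not_lt_zero _), fun i hi => absurd hi (Nat.not_lt_zero _)⟩
    · simp [Store.set_apply, h.count]
    · rcases hlm.lt_or_eq with h1 | rfl
      · simpa [Store.set_apply, h1.ne] using h.coord l (by omega)
      · rw [queryCoord_of_lt (Nat.lt_succ_self _)]
        simp [Store.set_apply]
    · simp [Store.set_apply, h.row]

theorem runs_queryStep (hn : 1 ≤ n) (hγ : 0 < γ) (hb : SizeBound I γ b) {i : Fin n} {m : ℕ}
    (hm : m < queryCount (accuracy n γ) I.α + 2) {s : Store} (h : QueryInv I γ b i m s) :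
    Runs I.oracle b 1 Reduction.queryStep s (QueryInv I γ b i (m + 1)) := by
  have hb1 : 1 ≤ b := le_trans (by norm_num) hb.lit
  have hl := ratSize_lit_le hb.lit
  have hm' : m ≤ queryCount (accuracy n γ) I.α + 1 := by omega
  have hcoord := h.coord m hm'
  have hv := validQuery_queryCoord (accuracy_pos hn hγ)
    ((accuracy_le hn hγ).trans_lt (by norm_num)) I.α_pos hm'
  have h1 := h.toRowInv.set (A := 7) (l := m) (by omega) (by omega) (by omega) (by omega)
    (hb.weight i m hm')
  have h2 := h1.set (A := 6) (l := 4) (by omega) (by omega) (by omega) (by omega)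
    (hb.sum i (m + 1) hm)
  have h3 := h2.set (A := 6) (l := 5) (by omega) (by omega) (by omega) (by omega) (hb.coord m)
  refine Runs.seq (R := fun s' => s' = s.set 7 m (queryWeight (I.oracle i) (accuracy n γ) I.α m))
    hb1 le_rfl ?_ ?_
  · refine Runs.query (l := m) (m := i) h.bounded hb1 le_rfl (by simp [Expr.val, h.col])
      (by simp [Expr.val, h.row]) ?_ ?_
      (by simp [Expr.LitBounded, hl]) (by simp [Expr.LitBounded, hl])
      (by simp [Expr.LitBounded, hl]) (by simp [Expr.LitBounded, hl])
      (by simp [Expr.LitBounded, hl]) ?_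
    · simpa [Expr.val, h.col, h.eps, h.prev, hcoord] using hv
    · simpa [Expr.val, h.col, h.eps, h.prev, hcoord] using hb.time i m hm'
    · simp [Expr.val, h.col, h.eps, h.prev, hcoord, queryWeight]
  rintro _ rfl
  refine runs_write_seq (l := 4)
    (q := ∑ l ∈ Finset.range (m + 1), queryWeight (I.oracle i) (accuracy n γ) I.α l)
    h1.bounded hb1 le_rfl (by simp [Expr.val])
    (by simp [Expr.val, Store.set_apply, h.total, h.col, Finset.sum_range_succ])
    (by simp [Expr.LitBounded, hl]) (by simp [Expr.LitBounded, hl]) ?_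
  refine runs_write_seq (l := 5) (q := queryCoord (accuracy n γ) I.α m)
    h2.bounded hb1 le_rfl (by simp [Expr.val])
    (by simp [Expr.val, Store.set_apply, h.col, hcoord])
    (by simp [Expr.LitBounded, hl]) (by simp [Expr.LitBounded, hl]) ?_
  refine Runs.write (l := 3) (q := ((m + 1 : ℕ) : ℚ)) h3.bounded hb1 le_rfl (by simp [Expr.val])
    (by simp [Expr.val, Store.set_apply, h.col])
    (by simp [Expr.LitBounded, hl]) (by simp [Expr.LitBounded, hl]) ?_
  refine ⟨h3.set (by omega) (by omega) (by omega) (by omega) (hb.natCast_count hm), ?_, ?_, ?_,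
    fun l hlm => ?_⟩
  · simp [Store.set_apply]
  · simp [Store.set_apply]
  · simp [Store.set_apply, queryPrev_succ]
  · rcases (Nat.le_of_lt_succ hlm).lt_or_eq with h4 | rfl
    · simpa [Store.set_apply, h4.ne] using h.answer l h4
    · simp [Store.set_apply]

theorem runs_normalizeStep (hb : SizeBound I γ b) {i : Fin n} {m : ℕ}
    (hm : m < queryCount (accuracy n γ) I.α + 2) {s : Store} (h : NormalizeInv I γ b i m s) :
    Runs I.oracle b 1 Reduction.normalizeStep s (NormalizeInv I γ b i (m + 1)) := by
  have hb1 : 1 ≤ b := le_trans (by norm_num) hb.lit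
  have hl := ratSize_lit_le hb.lit
  have h1 := h.toRowInv.set (A := 4) (l := i * (queryCount (accuracy n γ) I.α + 2) + m)
    (by omega) (by omega) (by omega) (by omega) (hb.prob i m (by omega))
  refine runs_write_seq (l := i * (queryCount (accuracy n γ) I.α + 2) + m)
    (q := queryProb (I.oracle i) (accuracy n γ) I.α m) h.bounded hb1 le_rfl
    (by simp [Expr.val, h.col, h.row, h.count])
    (by simp [Expr.val, h.col, h.total, h.answer m hm, queryProb])
    (by simp [Expr.LitBounded, hl]) (by simp [Expr.LitBounded, hl]) ?_
  refine Runs.write (l := 3) (q := ((m + 1 : ℕ) : ℚ)) h1.bounded hb1 le_rfl (by simp [Expr.val])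
    (by simp [Expr.val, Store.set_apply, h.col])
    (by simp [Expr.LitBounded, hl]) (by simp [Expr.LitBounded, hl]) ?_
  refine ⟨h1.set (by omega) (by omega) (by omega) (by omega) (hb.natCast_count hm), ?_, ?_,
    fun l hlm => ?_, fun l hlm => ?_⟩
  · simp [Store.set_apply]
  · simp [Store.set_apply, h.total]
  · simpa [Store.set_apply] using h.answer l hlm
  · rcases (Nat.le_of_lt_succ hlm).lt_or_eq with h4 | rfl
    · simpa [Store.set_apply, h4.ne] using h.current l h4
    · simp [Store.set_apply]

theorem runs_rowStep (hn : 1 ≤ n) (hγ : 0 < γ) (hb : SizeBound I γ b) (i : Fin n)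
    {s : Store} (h : RowInv I γ b i s) :
    Runs I.oracle b (queryCount (accuracy n γ) I.α + 3) Reduction.rowStep s
      (RowInv I γ b (i + 1)) := by
  have hb1 : 1 ≤ b := le_trans (by norm_num) hb.lit
  have hl := ratSize_lit_le hb.lit
  have hN : 1 ≤ queryCount (accuracy n γ) I.α + 3 := by omega
  have h1 := h.set (A := 6) (l := 3) (by omega) (by omega) (by omega) (by omega) hl.1
  have h2 := h1.set (A := 6) (l := 4) (by omega) (by omega) (by omega) (by omega) hl.1
  have h3 := h2.set (A := 6) (l := 5) (by omega) (by omega) (by omega) (by omega)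
    hl.2.2.2.2.2.2.2
  have hrem : ∀ m < queryCount (accuracy n γ) I.α + 2, ∀ s : Store,
      s 2 2 = queryCount (accuracy n γ) I.α → s 6 3 = m → 0 < Reduction.remaining.val s := by
    intro m hm s hcount hcol
    have : (m : ℚ) < queryCount (accuracy n γ) I.α + 2 := by exact_mod_cast hm
    simpa [Expr.val, hcount, hcol] using this
  have hrem' : ∀ s : Store, s 2 2 = queryCount (accuracy n γ) I.α →
      s 6 3 = ((queryCount (accuracy n γ) I.α + 2 : ℕ) : ℚ) →
      Reduction.remaining.val s ≤ 0 := by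
    intro s hcount hcol
    simp [Expr.val, hcount, hcol]
  refine runs_write_seq (l := 3) (q := 0) h.bounded hb1 hN (by simp [Expr.val])
    (by simp [Expr.val]) (by simp [Expr.LitBounded, hl]) (by simp [Expr.LitBounded, hl]) ?_
  refine runs_write_seq (l := 4) (q := 0) h1.bounded hb1 hN (by simp [Expr.val])
    (by simp [Expr.val]) (by simp [Expr.LitBounded, hl]) (by simp [Expr.LitBounded, hl]) ?_
  refine runs_write_seq (l := 5) (q := -1) h2.bounded hb1 hN (by simp [Expr.val])
    (by simp [Expr.val]) (by simp [Expr.LitBounded, hl]) (by simp [Expr.LitBounded, hl]) ?_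
  refine Runs.seq (R := QueryInv I γ b i (queryCount (accuracy n γ) I.α + 2)) hb1 hN ?_ ?_
  · refine Runs.loop (Inv := QueryInv I γ b i) (L := queryCount (accuracy n γ) I.α + 2) hb1 le_rfl
      (by omega) (by simp [Expr.LitBounded, hl]) (fun m s h => h.bounded)
      (fun m hm s h => ⟨hrem m hm s h.count h.col, runs_queryStep hn hγ hb hm h⟩)
      (fun s h => ⟨hrem' s h.count h.col, h⟩) ?_
    refine ⟨h3, ?_, ?_, ?_, fun l hl0 => absurd hl0 (Nat.not_lt_zero _)⟩
    · simp [Store.set_apply]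
    · simp [Store.set_apply]
    · simp [Store.set_apply, queryPrev_zero]
  intro s h
  have h4 := h.toRowInv.set (A := 6) (l := 3) (by omega) (by omega) (by omega) (by omega) hl.1
  refine runs_write_seq (l := 3) (q := 0) h.bounded hb1 hN (by simp [Expr.val])
    (by simp [Expr.val]) (by simp [Expr.LitBounded, hl]) (by simp [Expr.LitBounded, hl]) ?_
  refine Runs.seq (R := NormalizeInv I γ b i (queryCount (accuracy n γ) I.α + 2)) hb1 hN ?_ ?_
  · refine Runs.loop (Inv := NormalizeInv I γ b i) (L := queryCount (accuracy n γ) I.α + 2) hb1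
      le_rfl (by omega) (by simp [Expr.LitBounded, hl]) (fun m s h => h.bounded)
      (fun m hm s h => ⟨hrem m hm s h.count h.col, runs_normalizeStep hb hm h⟩)
      (fun s h => ⟨hrem' s h.count h.col, h⟩) ?_
    refine ⟨h4, ?_, ?_, fun l hlm => ?_, fun l hl0 => absurd hl0 (Nat.not_lt_zero _)⟩
    · simp [Store.set_apply]
    · simp [Store.set_apply, h.total]
    · simpa [Store.set_apply] using h.answer l hlm
  intro s h
  have h5 := h.toRowInv.set (A := 5) (l := i) (by omega) (by omega) (by omega) (by omega)
    (hb.cost i)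
  refine runs_write_seq (l := i) (q := I.c i) h.bounded hb1 hN (by simp [Expr.val, h.row])
    (by simp [Expr.val, h.row, h.cost]) (by simp [Expr.LitBounded, hl])
    (by simp [Expr.LitBounded, hl]) ?_
  refine Runs.write (l := 2) (q := ((i + 1 : ℕ) : ℚ)) h5.bounded hb1 hN (by simp [Expr.val])
    (by simp [Expr.val, Store.set_apply, h.row])
    (by simp [Expr.LitBounded, hl]) (by simp [Expr.LitBounded, hl]) ?_
  refine ⟨h5.toGridInv.set (by omega) (by omega) (hb.natCast_dim i.2), ?_, fun j hj l hlm => ?_,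
    fun j hj => ?_⟩
  · simp [Store.set_apply]
  · rcases (Nat.le_of_lt_succ hj).lt_or_eq with h6 | h6
    · simpa [Store.set_apply] using h.prob j h6 l hlm
    · obtain rfl := Fin.ext h6
      simpa [Store.set_apply] using h.current l hlm
  · rcases (Nat.le_of_lt_succ hj).lt_or_eq with h6 | h6
    · simpa [Store.set_apply, h6.ne] using h.outCost j h6
    · obtain rfl := Fin.ext h6
      simp [Store.set_apply]

/-- The factor `M + 3` counts the `M + 2` iterations of an inner loop and its failing test, and `n +
1` does the same for the rows. -/
theorem runs_program (hn : 1 ≤ n) (hγ : 0 < γ) (hb : SizeBound I γ b) :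
    Runs I.oracle b ((n + 1) * (queryCount (accuracy n γ) I.α + 3)) Reduction.program
      (inputStore I γ) (fun s => s.Holds (reducedInstance I hn hγ)) := by
  have hb1 : 1 ≤ b := le_trans (by norm_num) hb.lit
  have hl := ratSize_lit_le hb.lit
  have hN : 1 ≤ (n + 1) * (queryCount (accuracy n γ) I.α + 3) := Nat.mul_pos (by omega) (by omega)
  refine Runs.seq hb1 hN ((runs_grid hn hγ hb).mono (by nlinarith) fun _ h => h) fun s hs => ?_
  refine Runs.loop (Inv := RowInv I γ b) (L := n) hb1 (by omega) le_rfl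
    (by simp [Expr.LitBounded, hl]) (fun m s h => h.bounded) (fun m hm s h => ?_)
    (fun s h => ⟨?_, ?_⟩) hs
  · refine ⟨?_, runs_rowStep hn hγ hb ⟨m, hm⟩ h⟩
    have : (m : ℚ) < n := by exact_mod_cast hm
    simpa [Expr.val, h.dim, h.row] using this
  · simp [Expr.val, h.dim, h.row]
  · exact ⟨h.outDim, h.outCoverSize, h.count, fun j => h.coord j (Nat.le_of_lt_succ j.2),
      fun i j => h.prob i i.2 j j.2, fun i => h.outCost i i.2⟩

end Correctness

/-! ## Polynomial bounds -/

theorem polynomial_eval_mono (P : Polynomial ℕ) {x y : ℕ} (h : x ≤ y) : P.eval x ≤ P.eval y := by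
  rw [Polynomial.eval_eq_sum, Polynomial.eval_eq_sum]
  exact Finset.sum_le_sum fun i _ => Nat.mul_le_mul_left _ (Nat.pow_le_pow_left h i)

section Bounds

variable {n : ℕ} (I : Instance n) (γ : ℚ)

theorem ratSize_pos (x : ℚ) : 0 < ratSize x := by
  unfold ratSize
  omega

/-- Every cost entry has positive length, so the size bounds `n` itself and not merely its number of
digits. -/
theorem dim_le_size : n ≤ I.size := by
  have h : ∑ _i : Fin n, 1 ≤ ∑ i, ratSize (I.c i) :=
    Finset.sum_le_sum fun i _ => ratSize_pos (I.c i)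
  simp only [Finset.sum_const, Finset.card_univ, Fintype.card_fin, smul_eq_mul, mul_one] at h
  unfold Instance.size
  omega

theorem ratSize_cost_le_size (i : Fin n) : ratSize (I.c i) ≤ I.size := by
  have h := Finset.single_le_sum (f := fun i => ratSize (I.c i)) (fun _ _ => Nat.zero_le _)
    (Finset.mem_univ i)
  unfold Instance.size
  omega

theorem ratSize_accuracy_le : ratSize (accuracy n γ) ≤ ratSize γ + 60 * n + 5 := by
  have h1 : ratSize (min γ 1) ≤ ratSize γ + 3 := by
    rcases min_choice γ 1 with h | h <;> rw [h]
    · omega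
    · have := ratSize_natCast_le 1
      push_cast at this
      omega
  have h2 := ratSize_natCast_le (60 * n)
  have h3 := ratSize_div_le (min γ 1) (60 * n : ℕ)
  push_cast at h2 h3
  unfold accuracy
  omega

/-- Provides an integer upper bound for `1/ε`, polynomial in `n` and `⌈1/γ⌉`. -/
theorem one_le_mul_accuracy (hn : 1 ≤ n) {γ : ℚ} (hγ : 0 < γ) :
    1 ≤ ((60 * n * (⌈γ⁻¹⌉₊ + 1) : ℕ) : ℚ) * accuracy n γ := by
  have h : ((60 * n * (⌈γ⁻¹⌉₊ + 1) : ℕ) : ℚ) * accuracy n γ = (⌈γ⁻¹⌉₊ + 1) * min γ 1 := by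
    rw [← accuracy_mul hn γ]
    push_cast
    ring
  rw [h]
  have h0 : (0 : ℚ) ≤ ⌈γ⁻¹⌉₊ := Nat.cast_nonneg _
  rcases le_total γ 1 with h1 | h1
  · rw [min_eq_left h1]
    have h2 : 1 ≤ (⌈γ⁻¹⌉₊ : ℚ) * γ := (inv_le_iff_one_le_mul₀ hγ).1 (Nat.le_ceil γ⁻¹)
    linarith
  · rw [min_eq_right h1]
    linarith

/-- By Bernoulli, `N` steps at least double the power, and `1/(ε α)` is at most the denominator of
`ε α`, hence at most `2` to its encoding length. -/
theorem queryCount_le_mul {ε α : ℚ} (hε : 0 < ε) (hα : 0 < α) {N : ℕ} (hN : 1 ≤ N * ε) :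
    queryCount ε α ≤ N * ratSize (ε * α) := by
  rw [queryCount_le_iff hε hα]
  have hpos : 0 < ε * α := mul_pos hε hα
  have h1 : (2 : ℚ) ≤ (1 + ε) ^ N := by
    have := one_add_mul_le_pow (a := ε) (by linarith) N
    linarith
  have h2 : ((ε * α).den : ℚ) ≤ 2 ^ ratSize (ε * α) := by
    exact_mod_cast (Nat.lt_size_self _).le.trans
      (Nat.pow_le_pow_right two_pos (size_den_lt_ratSize (ε * α)).le)
  have h3 : 1 ≤ ε * α * (ε * α).den := by
    rw [Rat.mul_den_eq_num]
    exact_mod_cast Rat.num_pos.2 hpos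
  calc 1 ≤ ε * α * (ε * α).den := h3
    _ ≤ ε * α * 2 ^ ratSize (ε * α) := by gcongr
    _ ≤ ε * α * ((1 + ε) ^ N) ^ ratSize (ε * α) := by gcongr
    _ = ε * α * (1 + ε) ^ (N * ratSize (ε * α)) := by rw [pow_mul]

theorem ratSize_power_le (ε α : ℚ) (m : ℕ) :
    ratSize (ε * α * (1 + ε) ^ m) ≤ ratSize ε + ratSize α + m * (2 * ratSize ε + 6) + 3 := by
  have h1 := ratSize_mul_le (ε * α) ((1 + ε) ^ m)
  have h2 := ratSize_mul_le ε α
  have h3 := ratSize_pow_le (1 + ε) m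
  have h4 := ratSize_add_le 1 ε
  have h5 := ratSize_natCast_le 1
  push_cast at h5
  have h6 := Nat.mul_le_mul_left m (show ratSize (1 + ε) ≤ 2 * ratSize ε + 6 by omega)
  omega

theorem ratSize_queryCoord_le {ε α : ℚ} {a : ℕ} (ha : 3 ≤ a)
    (h : ∀ m ≤ queryCount ε α, ratSize (ε * α * (1 + ε) ^ m) ≤ a) (l : ℕ) :
    ratSize (queryCoord ε α l) ≤ a := by
  have h0 := ratSize_natCast_le 0
  have h1 := ratSize_natCast_le 1
  push_cast at h0 h1
  unfold queryCoord
  split_ifs with hl hl'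
  exacts [by omega, h _ (by omega), by omega]

theorem ratSize_queryPrev_le {ε α : ℚ} {a : ℕ} (ha : 3 ≤ a)
    (h : ∀ m ≤ queryCount ε α, ratSize (ε * α * (1 + ε) ^ m) ≤ a) (l : ℕ) :
    ratSize (queryPrev ε α l) ≤ a := by
  rcases l with _ | l
  · have h1 := ratSize_natCast_le 1
    push_cast at h1
    rw [queryPrev_zero, ratSize_neg]
    omega
  · exact ratSize_queryCoord_le ha h l

/-- A bound for all numbers of the reduction, from a bound `e` for the input and the accuracy, a
bound `m` for the number of grid points, and bounds `a` for the grid and `w` for the oracles. -/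
theorem sizeBound_of_le {I : Instance n} {γ : ℚ} (hn : 1 ≤ n) (hγ : 0 < γ) {P : Polynomial ℕ}
    (hP : ∀ i, (I.oracle i).RunsWithin P) {e m a w : ℕ} (hsize : I.size ≤ e)
    (hparam : ratSize γ ≤ e) (heps : ratSize (accuracy n γ) ≤ e)
    (hcount : queryCount (accuracy n γ) I.α ≤ m) (ha : 2 * e + m * (2 * e + 6) + 3 ≤ a)
    (hw : P.eval (2 * a + e) ≤ w) :
    SizeBound I γ (e + m + a + 2 * ((m + 2) * w) + w + 62) := by
  have hε := accuracy_pos hn hγ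
  have hε1 : accuracy n γ < 1 := (accuracy_le hn hγ).trans_lt (by norm_num)
  have hα : ratSize I.α ≤ e := le_trans (by unfold Instance.size; omega) hsize
  have hk : Nat.size I.k ≤ e := le_trans (by unfold Instance.size; omega) hsize
  have hpow : ∀ l ≤ queryCount (accuracy n γ) I.α,
      ratSize (accuracy n γ * I.α * (1 + accuracy n γ) ^ l) ≤ a := by
    intro l hl
    refine (ratSize_power_le _ _ _).trans (le_trans ?_ ha)
    have := Nat.mul_le_mul (hl.trans hcount)
      (show 2 * ratSize (accuracy n γ) + 6 ≤ 2 * e + 6 by omega)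
    omega
  have htime : ∀ i, ∀ l ≤ queryCount (accuracy n γ) I.α + 1,
      ratSize (queryWeight (I.oracle i) (accuracy n γ) I.α l) ≤ w ∧
      (I.oracle i).time (queryPrev (accuracy n γ) I.α l) (queryCoord (accuracy n γ) I.α l)
        (accuracy n γ) ≤ w := by
    intro i l hl
    obtain ⟨h1, h2⟩ := hP i _ _ _ (validQuery_queryCoord hε hε1 I.α_pos hl)
    have h3 := ratSize_queryCoord_le (by omega) hpow l
    have h4 := ratSize_queryPrev_le (by omega) hpow l
    have h5 := h2.trans ((polynomial_eval_mono P (by omega)).trans hw)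
    exact ⟨h1.trans h5, h5⟩
  -- Answers are nonnegative, so partial sums are at most the full sum, which is at most `1 + ε ≤
  -- 2`; only the denominators need a bound.
  have hsum : ∀ i, ∀ j ≤ queryCount (accuracy n γ) I.α + 2,
      ratSize (∑ l ∈ Finset.range j, queryWeight (I.oracle i) (accuracy n γ) I.α l) ≤
        2 * ((m + 2) * w) + 6 := by
    intro i j hj
    have := I.isProb i
    have hnonneg : ∀ l ∈ Finset.range (queryCount (accuracy n γ) I.α + 2),
        0 ≤ queryWeight (I.oracle i) (accuracy n γ) I.α l := fun l hl =>
      queryWeight_nonneg (I.nice i).1 hε hε1 I.α_pos (Nat.le_of_lt_succ (Finset.mem_range.1 hl))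
    have hsub := Finset.range_subset_range.2 hj
    have h1 := Finset.sum_le_sum_of_subset_of_nonneg hsub fun l hl _ => hnonneg l hl
    have h2 := sum_queryWeight_le (I.nice i).1 hε hε1 I.α_pos
    have h3 := size_den_sum_le (Finset.range j)
      (fun l => queryWeight (I.oracle i) (accuracy n γ) I.α l) fun l hl =>
        (htime i l (by have := Finset.mem_range.1 hl; omega)).1
    rw [Finset.card_range] at h3
    have h4 := Nat.mul_le_mul_right w (show j ≤ m + 2 by omega)
    have h5 := ratSize_le_of_le_two (Finset.sum_nonneg fun l hl => hnonneg l (hsub hl))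
      (h1.trans (h2.trans (by linarith)))
    omega
  refine ⟨by omega, by omega, ?_, by omega, fun i => ?_, ?_, ?_, by omega, fun l hl => ?_,
    fun i l hl => ?_, fun i j hj => ?_, fun i l hl => ?_, fun i l hl => ?_⟩
  · rw [ratSize_natCast]
    omega
  · have := ratSize_cost_le_size I i
    omega
  · have := ratSize_natCast_le n
    have := dim_le_size I
    omega
  · have := ratSize_natCast_le (queryCount (accuracy n γ) I.α + 2)
    omega
  · have := hpow l hl
    omega
  · have := (htime i l hl).1
    omega
  · have := hsum i j hj
    omega
  · have h1 := ratSize_div_le (queryWeight (I.oracle i) (accuracy n γ) I.α l)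
      (∑ t ∈ Finset.range (queryCount (accuracy n γ) I.α + 2),
        queryWeight (I.oracle i) (accuracy n γ) I.α t)
    have h2 := (htime i l hl).1
    have h3 := hsum i _ le_rfl
    unfold queryProb
    omega
  · have := (htime i l hl).2
    omega

end Bounds

theorem exists_polynomial_program (P : Polynomial ℕ) :
    ∃ T : Polynomial ℕ, ∀ (n : ℕ) (hn : 1 ≤ n) (I : Instance n)
      (_ : ∀ i, (I.oracle i).RunsWithin P) (γ : ℚ) (hγ : 0 < γ),
      ∃ (s : Store) (t : ℕ), Exec I.oracle Reduction.program (inputStore I γ) s t ∧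
        s.Holds (reducedInstance I hn hγ) ∧ t ≤ T.eval (⌈γ⁻¹⌉₊ + I.size + ratSize γ) := by
  -- The bounds of `sizeBound_of_le` as polynomials in the input length. `61x + 5` covers `ratSize γ
  -- + 60n + 5`, the bound for the length of `ε`; next, `60x(x + 1)` covers the bound for `1/ε` and
  -- `2e` the length of `ε α`.
  obtain ⟨e, he⟩ : ∃ e : Polynomial ℕ, ∀ x, e.eval x = 61 * x + 5 :=
    ⟨61 * .X + 5, fun x => by simp⟩
  obtain ⟨m, hm⟩ : ∃ m : Polynomial ℕ, ∀ x, m.eval x = 60 * x * (x + 1) * (2 * e.eval x) :=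
    ⟨60 * .X * (.X + 1) * (2 * e), fun x => by simp⟩
  obtain ⟨a, ha⟩ : ∃ a : Polynomial ℕ, ∀ x,
      a.eval x = 2 * e.eval x + m.eval x * (2 * e.eval x + 6) + 3 :=
    ⟨2 * e + m * (2 * e + 6) + 3, fun x => by simp⟩
  obtain ⟨w, hw⟩ : ∃ w : Polynomial ℕ, ∀ x, w.eval x = P.eval (2 * a.eval x + e.eval x) :=
    ⟨P.comp (2 * a + e), fun x => by simp⟩
  refine ⟨(Reduction.program.weight : Polynomial ℕ) *
    (e + m + a + 2 * ((m + 2) * w) + w + 62) * ((.X + 1) * (m + 3)),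
    fun n hn I hP γ hγ => ?_⟩
  set L := ⌈γ⁻¹⌉₊ + I.size + ratSize γ with hL
  have hε := accuracy_pos hn hγ
  have hnL := dim_le_size I
  have hεe : ratSize (accuracy n γ) ≤ e.eval L := by
    have := ratSize_accuracy_le (n := n) γ
    rw [he]
    omega
  have hα : ratSize I.α ≤ e.eval L := by
    have : ratSize I.α ≤ I.size := by unfold Instance.size; omega
    rw [he]
    omega
  have hcount : queryCount (accuracy n γ) I.α ≤ m.eval L := by
    refine (queryCount_le_mul hε I.α_pos (one_le_mul_accuracy hn hγ)).trans ?_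
    have := ratSize_mul_le (accuracy n γ) I.α
    rw [hm]
    gcongr <;> omega
  obtain ⟨s, t, hx, hs, ht⟩ := runs_program hn hγ (sizeBound_of_le hn hγ hP
    (e := e.eval L) (m := m.eval L) (a := a.eval L) (w := w.eval L)
    (by rw [he]; omega) (by rw [he]; omega) hεe hcount (ha L).ge (hw L).ge)
  refine ⟨s, t, hx, hs, ht.trans ?_⟩
  simp only [Polynomial.eval_mul, Polynomial.eval_add, Polynomial.eval_natCast,
    Polynomial.eval_X, Polynomial.eval_ofNat, Polynomial.eval_one, Nat.cast_id]
  gcongr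
  omega

end ParetoCover

theorem mainTheorem5 :
    ∃ R : ParetoCover.Program,
      ∀ P : Polynomial ℕ, ∃ T : Polynomial ℕ,
        ∀ (n : ℕ) (_ : 1 ≤ n) (I : ParetoCover.Instance n)
          (_ : ∀ i, (I.oracle i).RunsWithin P) (γ : ℚ) (_ : 0 < γ),
          ∃ J : ParetoCover.DiscreteInstance n,
            ParetoCover.IsReducedInstance I γ J ∧
            (∀ B : Finset (Fin n → unitInterval),
              ParetoCover.IsApproxSolution J.measure J.c J.k (1 + (γ : ℝ) / 15) B →
              ParetoCover.IsApproxSolution I.measure I.c I.k (1 + (γ : ℝ)) B) ∧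
            ∃ (s : ParetoCover.Store) (t : ℕ),
              ParetoCover.Exec I.oracle R (ParetoCover.inputStore I γ) s t ∧
              s.Holds J ∧
              t ≤ T.eval (⌈γ⁻¹⌉₊ + I.size + ParetoCover.ratSize γ) := by
  refine ⟨ParetoCover.Reduction.program, fun P => ?_⟩
  obtain ⟨T, hT⟩ := ParetoCover.exists_polynomial_program P
  refine ⟨T, fun n hn I hP γ hγ => ⟨ParetoCover.reducedInstance I hn hγ,
    ParetoCover.isReducedInstance_reducedInstance I hn hγ, fun B hB => hB.of_reducedInstance,
    hT n hn I hP γ hγ⟩⟩
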